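/- **Setting.** For $\sigma>0$ let $u(x;\theta)$ be the density of $\mathcal N(\theta,\sigma^2)$, and for $\tau>0$ and $\psi:\mathbb R\to\mathbb R$ let $v(y;\theta)=\tau^{-1}\exp(-\psi((y-\theta)/\tau))$ be the density of $\mathcal Q_\theta$, $\theta\in\mathbb R$. Assume that $\int e^{-\psi}=1$, $\int e^{-2\psi}<\infty$, that $\psi$ is infinitely differentiable, and that there are $C_\psi\in\mathbb Z_{\ge0}$ and $\widetilde C_\psi>0$ such that for all integers $1\le k\le n$ $$\int_{\mathbb R} e^{-\psi(t)}\Big(\sum_{j=1}^n\frac{|\psi^{(j)}(t)|}{\widetilde C_\psi^{\,j}\,j!}\Big)^k dt\le (C_\psi n)!.$$ Put $\overline C_\psi=16\pi^2(2e)^{4(1+C_\psi)}e^{4(1+C_\psi)^2}$. For $\lambda>0$, $n\in\mathbb N$ let $D_{n,\lambda}(t)=\sum_{j=1}^n\frac{|\psi^{(j)}(t)|}{\lambda^j j!}$, $\mathcal A^{\complement}=\{t: D_{n,\lambda}(t)>1\}$, $$\mathsf{Err}(\psi,n,\lambda)=\int_{\mathcal A^{\complement}}e^{-\psi}+\max_{1\le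 k\le n}\int_{\mathcal A^{\complement}}e^{-\psi}D_{n,\lambda}^k,\qquad M(\psi,n,\lambda)=\max_{1\le k\le n}\sup_{t\in\mathbb R}e^{-\psi(t)+\psi(t/2)}\big[1+D_{n,\lambda}(t)^k\big]\in[1,\infty].$$ Let $$\mathcal S^\star_N(y\mid x)=\sum_{k=0}^N\frac{(-1)^k\sigma^{2k}}{(2k)!!}\,\partial_\theta^{2k}v(y;\theta)\Big|_{\theta=x},\qquad \mathcal T^\star_N(y\mid x)=\frac{\mathcal S^\star_N(y\mid x)\vee0}{\int_{\mathbb R}[\mathcal S^\star_N(y'\mid x)\vee0]\,dy'}.$$ Assume $2N+1\ge\overline C_\psi$, $\tau\ge 8e\,\sigma\max\{\widetilde C_\psi,\lambda N\}$ and $\sigma,\lambda>0$. **(a)** $\mathcal T^\star_N(\cdot\mid x)$ is a probability density for every $x$, and $$\sup_{\theta\in\mathbb R}\Big\|\int_{\mathbb R}\mathcal T^\star_N(\cdot\mid x)u(x;\theta)\,dx-v(\cdot;\theta)\Big\|_{\mathsf{TV}}\le\overline C_\psi\exp\Big(-(2e)^{-1}(2N+1)^{\frac1{2(1+C_\psi)}}\Big)+4\,\mathsf{Err}(\psi,2N,\lambda).$$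 **(b)** Computations are carried out on a randomized real random-access machine with procedure calls. Arithmetic, comparisons, indirect addressing, uniform random numbers in $[0,1]$, and the members of an arbitrary fixed family of measurable functions are unit-cost instructions, and programs may contain real constants. Suppose that programs of the machine draw an exact sample from the density $e^{-\psi}$ within $T_{\mathsf{samp}}\ge1$ steps, evaluate $\mathcal S^\star_N(y\mid x)$ for every $x,y\in\mathbb R$ within $T_{\mathsf{eval}}(N)\ge1$ steps, and evaluate $e^{-\psi(t)}$ for every $t\in\mathbb R$ within $T_{\mathsf{eval}}(N)$ steps. Let $\epsilon\in(0,1)$ and suppose in addition that $2N+1\ge\big(2e\log(3\overline C_\psi/\epsilon)\big)^{2(1+C_\psi)}$. Then there is a program $\mathsf K$ which, for every $T_{\mathsf{iter}}\in\mathbb N$, on input $(x,T_{\mathsf{iter}})$ with $x\in\mathbb R$ runs for $\mathcal O(T_{\mathsf{iter}}\cdot T_{\mathsf{samp}}\cdot T_{\mathsf{eval}}(N))$ steps, with a universal implied constant, and whose output on $X_\theta\sim\mathcal N(\theta,\sigma^2)$ satisfies, with $Y_\theta\sim\mathcal Q_\theta$, $$\sup_{\theta\in\mathbb R}\mathsf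 d_{\mathsf{TV}}\big(\mathsf K(X_\theta),Y_\theta\big)\le\exp\Big(-\frac{T_{\mathsf{iter}}}{4M(\psi,2N,\lambda)}\Big)+\frac\epsilon3+4\,\mathsf{Err}(\psi,2N,\lambda),$$ where the exponential is $1$ if $M(\psi,2N,\lambda)=\infty$. -/

import Mathlib

open MeasureTheory ProbabilityTheory
open scoped ENNReal NNReal Nat

/-! ### Total variation and deficiency -/

/-- The measure on `ℝ` with Lebesgue density `f` (used for nonnegative `f`). -/
noncomputable def densMeasure (f : ℝ → ℝ) : Measure ℝ :=
  volume.withDensity (fun y => ENNReal.ofReal (f y))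

/-- Total variation distance `sup_A |μ(A) - ν(A)|` over measurable sets (subtraction on `ℝ≥0∞` is
truncated, so the maximum of the two differences is the absolute difference). -/
noncomputable def tvDist (μ ν : Measure ℝ) : ℝ≥0∞ :=
  ⨆ (A : Set ℝ) (_ : MeasurableSet A), max (μ A - ν A) (ν A - μ A)

/-- TV deficiency `sup_θ ‖∫ T(· | x) u(x; θ) dx - v(·; θ)‖_TV` of the kernel `T`, written
`T y x`, from the source densities `u x θ` to the target densities `v y θ`. -/
noncomputable def deficiency (u v T : ℝ → ℝ → ℝ) : ℝ≥0∞ :=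
  ⨆ θ : ℝ, tvDist (densMeasure (fun y => ∫ x, T y x * u x θ)) (densMeasure (fun y => v y θ))

/-- `T(· | x)` is a probability density on `ℝ` for every `x`. -/
def IsMarkovDensity (T : ℝ → ℝ → ℝ) : Prop :=
  ∀ x, Measurable (fun y => T y x) ∧ (∀ y, 0 ≤ T y x) ∧ ∫⁻ y, ENNReal.ofReal (T y x) = 1

/-! ### Source, target and kernels -/

/-- Density of `N(θ, σ²)`. -/
noncomputable def sourceDensity (σ : ℝ) (x θ : ℝ) : ℝ :=
  1 / (Real.sqrt (2 * Real.pi) * σ) * Real.exp (-(x - θ) ^ 2 / (2 * σ ^ 2))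

/-- Location density `τ⁻¹ exp (-ψ ((y - θ) / τ))`. -/
noncomputable def targetDensity (ψ : ℝ → ℝ) (τ : ℝ) (y θ : ℝ) : ℝ :=
  1 / τ * Real.exp (-ψ ((y - θ) / τ))

/-- Truncated signed kernel
`S_N(y | x) = ∑_{k ≤ N} (-1)^k σ^{2k} / (2k)!! * ∂_θ^{2k} v(y; θ) |_{θ = x}`. -/
noncomputable def signedKernel (v : ℝ → ℝ → ℝ) (σ : ℝ) (N : ℕ) (y x : ℝ) : ℝ :=
  ∑ k ∈ Finset.range (N + 1),
    (-1) ^ k * σ ^ (2 * k) / ((2 * k)‼ : ℝ) * iteratedDeriv (2 * k) (fun θ => v y θ) x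

/-- Positive part of a signed kernel, normalized. -/
noncomputable def normalizedPosPart (S : ℝ → ℝ → ℝ) (y x : ℝ) : ℝ :=
  max (S y x) 0 / ∫ y', max (S y' x) 0

/-! ### Negative log-density -/

/-- `∑_{j=1}^n |ψ^{(j)}(t)| / (r^j j!)`. -/
noncomputable def derivSum (ψ : ℝ → ℝ) (n : ℕ) (r t : ℝ) : ℝ :=
  ∑ j ∈ Finset.Icc 1 n, |iteratedDeriv j ψ t| / (r ^ j * (j ! : ℝ))

/-- Regularity of the negative log-density `ψ`, with constants `C = C_ψ` and `Ct = C̃_ψ`. -/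
structure RegularNegLogDensity (ψ : ℝ → ℝ) (C : ℕ) (Ct : ℝ) : Prop where
  integral_eq_one : ∫ t, Real.exp (-ψ t) = 1
  integrable_sq : Integrable (fun t => Real.exp (-(2 * ψ t)))
  smooth : ContDiff ℝ (⊤ : ℕ∞) ψ
  const_pos : 0 < Ct
  moment : ∀ n : ℕ, 1 ≤ n → ∀ k ∈ Finset.Icc 1 n,
    Integrable (fun t => Real.exp (-ψ t) * derivSum ψ n Ct t ^ k) ∧
      ∫ t, Real.exp (-ψ t) * derivSum ψ n Ct t ^ k ≤ ((C * n)! : ℝ)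

/-- `C̄_ψ = 16 π² (2e)^{4(1+C)} e^{4(1+C)²}`. -/
noncomputable def Cbar (C : ℕ) : ℝ :=
  16 * Real.pi ^ 2 * (2 * Real.exp 1) ^ (4 * (1 + C)) * Real.exp 1 ^ (4 * (1 + C) ^ 2)

/-- `A(ψ, n, λ)`: the points where `∑_{j=1}^n |ψ^{(j)}(t)| / (λ^j j!) ≤ 1`. -/
def goodSet (ψ : ℝ → ℝ) (n : ℕ) (lam : ℝ) : Set ℝ := {t | derivSum ψ n lam t ≤ 1}

/-- `Err(ψ, n, λ)`, as an extended nonnegative real. -/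
noncomputable def errTerm (ψ : ℝ → ℝ) (n : ℕ) (lam : ℝ) : ℝ≥0∞ :=
  (∫⁻ t in (goodSet ψ n lam)ᶜ, ENNReal.ofReal (Real.exp (-ψ t))) +
    ⨆ k ∈ Finset.Icc 1 n, ∫⁻ t in (goodSet ψ n lam)ᶜ,
      ENNReal.ofReal (Real.exp (-ψ t) * derivSum ψ n lam t ^ k)

/-- `M(ψ, n, λ)`, as an extended nonnegative real (it may be infinite). -/
noncomputable def ratioBound (ψ : ℝ → ℝ) (n : ℕ) (lam : ℝ) : ℝ≥0∞ :=
  ⨆ k ∈ Finset.Icc 1 n, ⨆ t : ℝ,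
    ENNReal.ofReal (Real.exp (-ψ t + ψ (t / 2)) * (1 + derivSum ψ n lam t ^ k))

/-! ### Randomized real random-access machines

Programs act on a memory of real registers `0, 1, 2, …`. Each executed instruction costs one unit
of time; a procedure call costs one unit plus the running time of the procedure. -/

/-- A family of measurable binary functions offered as unit-cost instructions in addition to the
arithmetic ones (a unary function is one that ignores its second argument). -/
structure Primitives where
  ι : Type
  fn : ι → ℝ × ℝ → ℝ
  measurable_fn : ∀ i, Measurable (fn i)

/-- The four arithmetic operations. -/
inductive Arith
  | add | sub | mul | div

/-- Action of an arithmetic operation (with `x / 0 = 0`). -/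
noncomputable def Arith.apply : Arith → ℝ × ℝ → ℝ
  | .add => fun z => z.1 + z.2
  | .sub => fun z => z.1 - z.2
  | .mul => fun z => z.1 * z.2
  | .div => fun z => z.1 / z.2

theorem Arith.measurable_apply (o : Arith) : Measurable o.apply := by
  cases o
  · exact measurable_fst.add measurable_snd
  · exact measurable_fst.sub measurable_snd
  · exact measurable_fst.mul measurable_snd
  · exact measurable_fst.div measurable_snd

/-- Programs. -/
inductive Cmd (P : Primitives) where
  /-- `r_d := c` -/
  | const (d : ℕ) (c : ℝ)
  /-- `r_d := r_a ∘ r_b` for an arithmetic operation `∘` -/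
  | arith (o : Arith) (d a b : ℕ)
  /-- `r_d := f (r_a, r_b)` for an additional primitive `f` -/
  | prim (i : P.ι) (d a b : ℕ)
  /-- `r_d := r_{⌊r_a⌋}` -/
  | load (d a : ℕ)
  /-- `r_{⌊r_a⌋} := r_b` -/
  | store (a b : ℕ)
  /-- `r_d :=` a fresh uniform random number in `[0, 1]` -/
  | unif (d : ℕ)
  /-- `p; q` -/
  | seq (p q : Cmd P)
  /-- `if 0 < r_a then p else q` -/
  | branch (a : ℕ) (p q : Cmd P)
  /-- `while 0 < r_a do p` -/
  | loop (a : ℕ) (p : Cmd P)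
  /-- run `p` in a fresh memory with `r_a, r_b` in registers `0, 1` and zeros elsewhere;
  then `r_d :=` the content of register `0` of that memory -/
  | call (d : ℕ) (p : Cmd P) (a b : ℕ)

/-- Memory content together with the time used so far. -/
abbrev MState := (ℕ → ℝ) × ℕ

/-- Initial state on the input pair `(x, y)`. -/
def initState (z : ℝ × ℝ) : MState :=
  (fun i => if i = 0 then z.1 else if i = 1 then z.2 else 0, 0)

theorem measurable_initState : Measurable initState := by
  refine Measurable.prodMk (measurable_pi_lambda _ fun i => ?_) measurable_const
  by_cases h0 : i = 0
  · simpa [h0] using measurable_fst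
  · by_cases h1 : i = 1
    · simpa [h1] using measurable_snd
    · simp [h0, h1]

/-- Write `x` into register `d` and advance the clock by `n`. -/
def write (d : ℕ) (s : MState) (x : ℝ) (n : ℕ) : MState :=
  (Function.update s.1 d x, s.2 + n)

theorem measurable_write (d : ℕ) {α : Type*} [MeasurableSpace α] {f : α → MState} {g : α → ℝ}
    {h : α → ℕ} (hf : Measurable f) (hg : Measurable g) (hh : Measurable h) :
    Measurable (fun a => write d (f a) (g a) (h a)) := by
  refine Measurable.prodMk (measurable_pi_lambda _ fun i => ?_) ((measurable_snd.comp hf).add hh)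
  by_cases hi : i = d
  · subst hi; simpa using hg
  · simp only [Function.update_of_ne hi]
    exact (measurable_pi_apply i).comp (measurable_fst.comp hf)

theorem measurable_reg (a : ℕ) : Measurable (fun s : MState => s.1 a) :=
  (measurable_pi_apply a).comp measurable_fst

theorem measurableSet_guard (a : ℕ) : MeasurableSet {s : MState | 0 < s.1 a} :=
  measurableSet_lt measurable_const (measurable_reg a)

theorem measurable_load (a : ℕ) : Measurable (fun s : MState => s.1 ⌊s.1 a⌋₊) := by
  have h : Measurable (fun q : ℕ × MState => q.2.1 q.1) :=
    measurable_from_prod_countable_right fun i => measurable_reg i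
  exact h.comp ((Nat.measurable_floor.comp (measurable_reg a)).prodMk measurable_id)

theorem measurable_store (a b : ℕ) :
    Measurable (fun s : MState => write ⌊s.1 a⌋₊ s (s.1 b) 1) := by
  have h : Measurable (fun q : ℕ × MState => write q.1 q.2 (q.2.1 b) 1) :=
    measurable_from_prod_countable_right fun i =>
      measurable_write i measurable_id (measurable_reg b) measurable_const
  exact h.comp ((Nat.measurable_floor.comp (measurable_reg a)).prodMk measurable_id)

/-- Advance the clock by one. -/
noncomputable def tick : Kernel MState MState :=
  Kernel.deterministic (fun s => (s.1, s.2 + 1)) (by fun_prop)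

/-- `k`-fold iterate of a kernel. -/
noncomputable def rounds (κ : Kernel MState MState) : ℕ → Kernel MState MState
  | 0 => Kernel.id
  | k + 1 => rounds κ k ∘ₖ κ

/-- The uniform distribution on `[0, 1]`. -/
noncomputable def unifMeasure : Measure ℝ := volume.restrict (Set.Icc 0 1)

/-- Semantics of a program: the law of the final state given the initial one. Mass is lost exactly
on diverging runs. A `while` loop is the sum over the number of rounds: that many passes through
test and body, then a failing test. A call runs the procedure on a clock of its own, whose final
reading is added to the clock of the caller. -/
noncomputable def Cmd.sem {P : Primitives} : Cmd P → Kernel MState MState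
  | .const d c =>
      Kernel.deterministic (fun s => write d s c 1)
        (measurable_write d measurable_id measurable_const measurable_const)
  | .arith o d a b =>
      Kernel.deterministic (fun s => write d s (o.apply (s.1 a, s.1 b)) 1)
        (measurable_write d measurable_id
          (o.measurable_apply.comp ((measurable_reg a).prodMk (measurable_reg b)))
          measurable_const)
  | .prim i d a b =>
      Kernel.deterministic (fun s => write d s (P.fn i (s.1 a, s.1 b)) 1)
        (measurable_write d measurable_id
          ((P.measurable_fn i).comp ((measurable_reg a).prodMk (measurable_reg b)))
          measurable_const)
  | .load d a =>
      Kernel.deterministic (fun s => write d s (s.1 ⌊s.1 a⌋₊) 1)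
        (measurable_write d measurable_id (measurable_load a) measurable_const)
  | .store a b =>
      Kernel.deterministic (fun s => write ⌊s.1 a⌋₊ s (s.1 b) 1) (measurable_store a b)
  | .unif d =>
      (Kernel.id ×ₖ Kernel.const MState unifMeasure).map (fun z => write d z.1 z.2 1)
  | .seq p q => q.sem ∘ₖ p.sem
  | .branch a p q => Kernel.piecewise (measurableSet_guard a) p.sem q.sem ∘ₖ tick
  | .loop a p =>
      Kernel.sum fun k : ℕ =>
        Kernel.piecewise (measurableSet_guard a) 0 tick ∘ₖ
          rounds (p.sem ∘ₖ Kernel.piecewise (measurableSet_guard a) tick 0) k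
  | .call d p a b =>
      (Kernel.id ×ₖ p.sem.comap (fun s => initState (s.1 a, s.1 b))
        (measurable_initState.comp ((measurable_reg a).prodMk (measurable_reg b)))).map
        (fun z => write d z.1 (z.2.1 0) (1 + z.2.2))

/-- Joint law of the output (the final content of register `0`) and the running time, given the
input pair. -/
noncomputable def Cmd.run {P : Primitives} (p : Cmd P) : Kernel (ℝ × ℝ) (ℝ × ℕ) :=
  (p.sem.comap initState measurable_initState).map (fun s => (s.1 0, s.2))

/-- Law of the output, given the input pair. -/
noncomputable def Cmd.out {P : Primitives} (p : Cmd P) : Kernel (ℝ × ℝ) ℝ :=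
  p.run.map Prod.fst

/-- On input `z` the program halts almost surely, after at most `T` steps. -/
def Cmd.HaltsWithin {P : Primitives} (p : Cmd P) (z : ℝ × ℝ) (T : ℕ) : Prop :=
  p.run z Set.univ = 1 ∧ ∀ᵐ r ∂(p.run z), r.2 ≤ T

/-- The program evaluates `f` at every point in at most `T` steps. -/
def Cmd.Computes {P : Primitives} (p : Cmd P) (f : ℝ × ℝ → ℝ) (T : ℕ) : Prop :=
  ∀ z, p.HaltsWithin z T ∧ p.out z = Measure.dirac (f z)

/-- The program (on the empty memory) draws an exact sample from `μ` in at most `T` steps. -/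
def Cmd.Samples {P : Primitives} (p : Cmd P) (μ : Measure ℝ) (T : ℕ) : Prop :=
  p.HaltsWithin (0, 0) T ∧ p.out (0, 0) = μ

/-- All program semantics are s-finite kernels, so that the products of kernels used above are the
genuine ones. -/
theorem Cmd.isSFiniteKernel_sem {P : Primitives} (p : Cmd P) : IsSFiniteKernel p.sem := by
  induction p with
  | const d c => rw [Cmd.sem]; infer_instance
  | arith o d a b => rw [Cmd.sem]; infer_instance
  | prim i d a b => rw [Cmd.sem]; infer_instance
  | load d a => rw [Cmd.sem]; infer_instance
  | store a b => rw [Cmd.sem]; infer_instance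
  | unif d => rw [Cmd.sem]; infer_instance
  | seq p q hp hq => rw [Cmd.sem]; infer_instance
  | branch a p q hp hq =>
    have : IsSFiniteKernel tick := by unfold tick; infer_instance
    rw [Cmd.sem]; infer_instance
  | loop a p hp =>
    have ht : IsSFiniteKernel tick := by unfold tick; infer_instance
    rw [Cmd.sem]
    have hpow : ∀ k : ℕ, IsSFiniteKernel
        (rounds (p.sem ∘ₖ Kernel.piecewise (measurableSet_guard a) tick 0) k) := by
      intro k
      induction k with
      | zero => rw [rounds]; infer_instance
      | succ k ih => rw [rounds]; infer_instance
    infer_instance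
  | call d p a b hp => rw [Cmd.sem]; infer_instance

/-!
The signed kernel is a truncated backward heat operator: it is the convolution with
`G = ∑_{k ≤ N} (-1)^k σ^{2k} / (2k)!! * v^{(2k)}`, where `v` is the target density at `θ = 0`.

*Deficiency.* Expand the summand `v^{(2k)} (y - h)` in powers of the Gaussian variable `h` up to
order `2 (N - k)`. Since the even Gaussian moments divided by factorials are `σ^{2j} / (2j)!!`,
smoothing turns the Taylor polynomials into a sum in which all terms except `v` cancel by
`(1 - 1)^m = 0` (`integral_heatTaylor`), and Taylor's theorem in `L¹`
(`lintegral_abs_taylorRem_le`) bounds the remainders by the `L¹` norm of `v^{(2N)}`. The positive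
part and the normalization each cost the mass of the negative part of `G`. Both quantities follow
from one pointwise bound, `abs_iteratedDeriv_exp_neg_le`: with `D = derivSum ψ m r`,
`|(e^{-ψ})^{(n)}| ≤ n! r^n e^{-ψ} max(1, D)^n` for `n ≤ m`. On the good set `D ≤ 1`, so that the
leading term of `G` dominates and `G ≥ 0`; off the good set the integrals of `e^{-ψ} D^n` are
exactly what `errTerm` measures. The scale condition makes the coefficients geometrically small, and
the error comes out as `32^{-N}` plus a multiple of `errTerm` (`tvDist_mixture_le`), which is much
smaller than the claimed rate.

*Algorithm.* The same pointwise bound shows `G ≤ 4 M` times the density of the proposal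
`x + 2 τ t`, `t ∼ e^{-ψ}`, so rejection sampling accepts each proposal with a probability `a`, the
same for all `x`, with `a ≥ 1 / (4 M)`, and an accepted proposal has the law of the normalized kernel
(`exists_acceptance`). The program runs a fixed number of rounds and returns the last accepted
proposal; it errs only if nothing is accepted, which has probability `(1 - a)^n ≤ exp (-n / (4 M))`.
Its law and its running time are computed together, by integrating test functions that depend only
on the output register as long as the clock stays below the bound (`lintegral_rejectionLoop`).
-/

namespace Cmd

variable {P : Primitives}

/-! ### Rules for the semantics of programs -/

theorem sem_seq_apply (p q : Cmd P) (s : MState) : (seq p q).sem s = (p.sem s).bind q.sem := by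
  rw [sem, Kernel.comp_apply]

theorem sem_seq_const (d : ℕ) (c : ℝ) (q : Cmd P) (s : MState) :
    (seq (const d c) q).sem s = q.sem (write d s c 1) := by
  rw [sem_seq_apply, sem, Kernel.deterministic_apply, Measure.dirac_bind q.sem.measurable]

theorem sem_seq_arith (o : Arith) (d a b : ℕ) (q : Cmd P) (s : MState) :
    (seq (arith o d a b) q).sem s = q.sem (write d s (o.apply (s.1 a, s.1 b)) 1) := by
  rw [sem_seq_apply, sem, Kernel.deterministic_apply, Measure.dirac_bind q.sem.measurable]

theorem sem_const_apply (d : ℕ) (c : ℝ) (s : MState) :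
    (const d c : Cmd P).sem s = Measure.dirac (write d s c 1) := by
  rw [sem, Kernel.deterministic_apply]

theorem sem_arith_apply (o : Arith) (d a b : ℕ) (s : MState) :
    (arith o d a b : Cmd P).sem s = Measure.dirac (write d s (o.apply (s.1 a, s.1 b)) 1) := by
  rw [sem, Kernel.deterministic_apply]

theorem sem_branch_apply (a : ℕ) (p q : Cmd P) (s : MState) :
    (branch a p q).sem s = if 0 < s.1 a then p.sem (s.1, s.2 + 1) else q.sem (s.1, s.2 + 1) := by
  rw [sem, Kernel.comp_apply, tick, Kernel.deterministic_apply,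
    Measure.dirac_bind (Kernel.measurable _), Kernel.piecewise_apply]
  rfl

theorem lintegral_seq (p q : Cmd P) (s : MState) {Φ : MState → ℝ≥0∞} (hΦ : Measurable Φ) :
    ∫⁻ s', Φ s' ∂(seq p q).sem s = ∫⁻ s', ∫⁻ s'', Φ s'' ∂q.sem s' ∂p.sem s := by
  rw [sem, Kernel.lintegral_comp _ _ _ hΦ]

theorem lintegral_unif (d : ℕ) (s : MState) {Φ : MState → ℝ≥0∞} (hΦ : Measurable Φ) :
    ∫⁻ s', Φ s' ∂(unif d : Cmd P).sem s = ∫⁻ u, Φ (write d s u 1) ∂unifMeasure := by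
  have : IsFiniteMeasure unifMeasure := by unfold unifMeasure; infer_instance
  have hw : Measurable (fun z : MState × ℝ => write d z.1 z.2 1) :=
    measurable_write d measurable_fst measurable_snd measurable_const
  rw [sem, Kernel.lintegral_map _ hw _ hΦ,
    Kernel.lintegral_id_prod (f := fun z => Φ (write d z.1 z.2 1)) (hΦ.comp hw)]
  simp

theorem lintegral_call (d : ℕ) (p : Cmd P) (a b : ℕ) (s : MState) {Φ : MState → ℝ≥0∞}
    (hΦ : Measurable Φ) :
    ∫⁻ s', Φ s' ∂(call d p a b).sem s =
      ∫⁻ z, Φ (write d s (z.1 0) (1 + z.2)) ∂p.sem (initState (s.1 a, s.1 b)) := by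
  have := p.isSFiniteKernel_sem
  have hw : Measurable (fun z : MState × MState => write d z.1 (z.2.1 0) (1 + z.2.2)) :=
    measurable_write d measurable_fst ((measurable_reg 0).comp measurable_snd)
      (measurable_const.add (measurable_snd.comp measurable_snd))
  rw [sem, Kernel.lintegral_map _ hw _ hΦ, Kernel.lintegral_id_prod
    (f := fun z : MState × MState => Φ (write d z.1 (z.2.1 0) (1 + z.2.2))) (hΦ.comp hw)]
  simp [Kernel.comap_apply]

/-- Unrolling of a loop: one test, then either the body followed by the loop again, or the end. -/
theorem lintegral_loop (a : ℕ) (p : Cmd P) (s : MState) {Φ : MState → ℝ≥0∞} (hΦ : Measurable Φ) :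
    ∫⁻ s', Φ s' ∂(loop a p).sem s =
      if 0 < s.1 a then ∫⁻ s', ∫⁻ s'', Φ s'' ∂(loop a p).sem s' ∂p.sem (s.1, s.2 + 1)
      else Φ (s.1, s.2 + 1) := by
  have hE : ∀ s' : MState, ∫⁻ s'', Φ s'' ∂(Kernel.piecewise (measurableSet_guard a) 0 tick) s' =
      if 0 < s'.1 a then 0 else Φ (s'.1, s'.2 + 1) := by
    intro s'
    rw [Kernel.lintegral_piecewise, tick, Kernel.lintegral_deterministic' _ hΦ]
    simp
  set E := Kernel.piecewise (measurableSet_guard a) 0 tick with hEdef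
  set B := p.sem ∘ₖ Kernel.piecewise (measurableSet_guard a) tick 0 with hB
  have hBs : ∀ (s' : MState) (F : MState → ℝ≥0∞), Measurable F → ∫⁻ s'', F s'' ∂B s' =
      if 0 < s'.1 a then ∫⁻ s'', F s'' ∂p.sem (s'.1, s'.2 + 1) else 0 := by
    intro s' F hF
    rw [hB, Kernel.lintegral_comp _ _ _ hF, Kernel.lintegral_piecewise, tick,
      Kernel.lintegral_deterministic' _ hF.lintegral_kernel]
    simp
  have hsem : ∀ s', ∫⁻ s'', Φ s'' ∂(loop a p).sem s' =
      ∑' k, ∫⁻ s'', Φ s'' ∂(E ∘ₖ rounds B k) s' := by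
    intro s'
    rw [sem, Kernel.sum_apply, lintegral_sum_measure]
  rw [hsem, tsum_eq_zero_add' ENNReal.summable]
  have h0 : ∫⁻ s'', Φ s'' ∂(E ∘ₖ rounds B 0) s = if 0 < s.1 a then 0 else Φ (s.1, s.2 + 1) := by
    rw [rounds, Kernel.comp_id, hE]
  have h1 : ∀ k, ∫⁻ s'', Φ s'' ∂(E ∘ₖ rounds B (k + 1)) s =
      if 0 < s.1 a then ∫⁻ s', ∫⁻ s'', Φ s'' ∂(E ∘ₖ rounds B k) s' ∂p.sem (s.1, s.2 + 1)
      else 0 := by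
    intro k
    rw [rounds, ← Kernel.comp_assoc, Kernel.lintegral_comp _ _ _ hΦ,
      hBs _ _ hΦ.lintegral_kernel]
  rw [h0]
  simp_rw [h1]
  by_cases hs : 0 < s.1 a
  · simp only [hs, if_true, zero_add]
    rw [← lintegral_tsum fun k => (hΦ.lintegral_kernel).aemeasurable]
    simp_rw [hsem]
  · simp [hs]

theorem run_apply (p : Cmd P) (z : ℝ × ℝ) :
    p.run z = (p.sem (initState z)).map (fun s => (s.1 0, s.2)) := by
  rw [run, Kernel.map_apply _ ((measurable_reg 0).prodMk measurable_snd), Kernel.comap_apply]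

theorem lintegral_out (p : Cmd P) (z : ℝ × ℝ) {Φ : ℝ → ℝ≥0∞} (hΦ : Measurable Φ) :
    ∫⁻ r, Φ r ∂p.out z = ∫⁻ s, Φ (s.1 0) ∂p.sem (initState z) := by
  rw [out, Kernel.lintegral_map _ measurable_fst _ hΦ, run_apply,
    lintegral_map (f := fun r : ℝ × ℕ => Φ r.1) (hΦ.comp measurable_fst)
      ((measurable_reg 0).prodMk measurable_snd)]

theorem HaltsWithin.ae_sem {p : Cmd P} {z : ℝ × ℝ} {T : ℕ} (h : p.HaltsWithin z T) :
    ∀ᵐ s ∂p.sem (initState z), s.2 ≤ T := by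
  have h2 := h.2
  rw [run_apply] at h2
  exact ae_of_ae_map ((measurable_reg 0).prodMk measurable_snd).aemeasurable h2

theorem HaltsWithin.sem_univ {p : Cmd P} {z : ℝ × ℝ} {T : ℕ} (h : p.HaltsWithin z T) :
    p.sem (initState z) Set.univ = 1 := by
  have h1 := h.1
  rwa [run_apply, Measure.map_apply ((measurable_reg 0).prodMk measurable_snd) .univ,
    Set.preimage_univ] at h1

/-- A call of a program that halts in time: the rest of the computation sees only the law of the
output and the bound on the time. -/
theorem lintegral_seq_call {p : Cmd P} {d a b T : ℕ} (q : Cmd P) {s : MState}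
    (hp : p.HaltsWithin (s.1 a, s.1 b) T) {Φ : MState → ℝ≥0∞} (hΦ : Measurable Φ)
    {G : ℝ → ℝ≥0∞} (hG : Measurable G)
    (h : ∀ v k, k ≤ T → ∫⁻ s', Φ s' ∂q.sem (write d s v (1 + k)) = G v) :
    ∫⁻ s', Φ s' ∂(seq (call d p a b) q).sem s = ∫⁻ v, G v ∂p.out (s.1 a, s.1 b) := by
  rw [lintegral_seq _ _ _ hΦ, lintegral_call _ _ _ _ _ hΦ.lintegral_kernel, lintegral_out _ _ hG]
  refine lintegral_congr_ae ?_
  filter_upwards [hp.ae_sem] with z hz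
  exact h _ _ hz

theorem lintegral_seq_call_computes {p : Cmd P} {f : ℝ × ℝ → ℝ} {d a b T : ℕ} (q : Cmd P)
    {s : MState} (hp : p.Computes f T) {Φ : MState → ℝ≥0∞} (hΦ : Measurable Φ) {c : ℝ≥0∞}
    (h : ∀ k, k ≤ T → ∫⁻ s', Φ s' ∂q.sem (write d s (f (s.1 a, s.1 b)) (1 + k)) = c) :
    ∫⁻ s', Φ s' ∂(seq (call d p a b) q).sem s = c := by
  obtain ⟨hH, hout⟩ := hp (s.1 a, s.1 b)
  have hv : ∀ᵐ z ∂p.sem (initState (s.1 a, s.1 b)), z.1 0 = f (s.1 a, s.1 b) := by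
    have h0 : ∀ᵐ v ∂p.out (s.1 a, s.1 b), v = f (s.1 a, s.1 b) := by
      rw [hout, ae_dirac_eq]; rfl
    rw [out, Kernel.map_apply _ measurable_fst, run_apply] at h0
    have := ae_of_ae_map measurable_fst.aemeasurable h0
    exact ae_of_ae_map ((measurable_reg 0).prodMk measurable_snd).aemeasurable this
  rw [lintegral_seq _ _ _ hΦ, lintegral_call _ _ _ _ _ hΦ.lintegral_kernel]
  calc _ = ∫⁻ _, c ∂p.sem (initState (s.1 a, s.1 b)) := by
        refine lintegral_congr_ae ?_
        filter_upwards [hH.ae_sem, hv] with z hz hzv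
        rw [hzv]
        exact h _ hz
    _ = c := by rw [lintegral_const, hH.sem_univ, mul_one]

end Cmd

namespace Cmd

variable {P : Primitives}

/-! ### Rejection sampling -/

/-- One round of rejection sampling for the location `x`, held in register `2`. It draws `t` with
`samp` and `u` uniformly, sets `y = x + scale * t`, and overwrites register `0` by `y` if
`m * dens t * u < ev (x, y)`; the counter in register `1` goes down by one. Register `9` is never
written and supplies the number `0`. -/
def rejectionStep (samp ev dens : Cmd P) (scale m : ℝ) : Cmd P :=
  seq (call 3 samp 9 9) <| seq (unif 4) <|
  seq (const 8 scale) <| seq (arith .mul 5 8 3) <| seq (arith .add 5 5 2) <|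
  seq (call 6 ev 2 5) <| seq (call 7 dens 3 9) <|
  seq (const 8 m) <| seq (arith .mul 7 7 8) <| seq (arith .mul 7 7 4) <|
  seq (arith .sub 6 6 7) <|
  seq (branch 6 (arith .add 0 5 9) (const 8 0)) <|
  seq (const 8 1) (arith .sub 1 1 8)

/-- Rejection sampling on input `(x, n)`: the output is the last accepted proposal out of `n`, or
`x` if there is none. Keeping the last accepted proposal rather than the first makes the number of
rounds deterministic. -/
def rejectionSampler (samp ev dens : Cmd P) (scale m : ℝ) : Cmd P :=
  seq (arith .add 2 0 9) (loop 1 (rejectionStep samp ev dens scale m))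

section
variable {samp ev dens : Cmd P} {S : ℝ → ℝ → ℝ} {f : ℝ → ℝ} {μ : Measure ℝ} {Ts Te : ℕ}

/-- The new content of register `0` after a round of rejection sampling with proposal `t` and
uniform number `u`. -/
noncomputable def rejectionUpdate (S : ℝ → ℝ → ℝ) (f : ℝ → ℝ) (scale m x r t u : ℝ) : ℝ :=
  if 0 < S (scale * t + x) x - f t * m * u then scale * t + x else r

theorem lintegral_rejectionStep (scale m : ℝ) (hsamp : samp.Samples μ Ts)
    (hev : ev.Computes (fun z => S z.2 z.1) Te) (hdens : dens.Computes (fun z => f z.1) Te)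
    (hS : ∀ x, Measurable fun y => S y x) (hf : Measurable f) (s : MState) (h9 : s.1 9 = 0)
    {Φ : MState → ℝ≥0∞} (hΦ : Measurable Φ) {H : ℝ → ℝ≥0∞} (hH : Measurable H)
    (h : ∀ s' : MState, s'.1 1 = s.1 1 - 1 → s'.1 2 = s.1 2 → s'.1 9 = 0 →
      s'.2 ≤ s.2 + (15 + Ts + 2 * Te) → Φ s' = H (s'.1 0)) :
    ∫⁻ s', Φ s' ∂(rejectionStep samp ev dens scale m).sem s =
      ∫⁻ t, ∫⁻ u, H (rejectionUpdate S f scale m (s.1 2) (s.1 0) t u) ∂unifMeasure ∂μ := by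
  have : IsFiniteMeasure unifMeasure := by unfold unifMeasure; infer_instance
  have hmeas : Measurable fun p : ℝ × ℝ =>
      H (rejectionUpdate S f scale m (s.1 2) (s.1 0) p.1 p.2) := by
    refine hH.comp (Measurable.ite ?_ (by fun_prop) (by fun_prop))
    have := hS (s.1 2)
    exact measurableSet_lt (by fun_prop) (by fun_prop)
  unfold rejectionStep
  rw [lintegral_seq_call _ (by rw [h9]; exact hsamp.1) hΦ
    (G := fun t => ∫⁻ u, H (rejectionUpdate S f scale m (s.1 2) (s.1 0) t u) ∂unifMeasure)
    hmeas.lintegral_prod_right' ?_, h9, hsamp.2]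
  intro t k hk
  rw [lintegral_seq _ _ _ hΦ, lintegral_unif _ _ hΦ.lintegral_kernel]
  refine lintegral_congr fun u => ?_
  rw [sem_seq_const, sem_seq_arith, sem_seq_arith]
  refine lintegral_seq_call_computes _ hev hΦ fun k₁ hk₁ => ?_
  refine lintegral_seq_call_computes _ hdens hΦ fun k₂ hk₂ => ?_
  rw [sem_seq_const, sem_seq_arith, sem_seq_arith, sem_seq_arith, sem_seq_apply, sem_branch_apply]
  split_ifs with hg
  all_goals
    simp only [write, Arith.apply, Function.update_apply] at hg
    norm_num at hg
    simp only [sem_arith_apply, sem_const_apply]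
    rw [Measure.dirac_bind (Kernel.measurable _), sem_seq_const, sem_arith_apply,
      lintegral_dirac' _ hΦ, h]
  · simp [write, Arith.apply, rejectionUpdate, h9, hg]
  · simp [write, Arith.apply]
  · simp [write]
  · simp [write, h9]
  · simp only [write]; omega
  · simp [write, Arith.apply, rejectionUpdate, hg.not_gt]
  · simp [write, Arith.apply]
  · simp [write]
  · simp [write, h9]
  · simp only [write]; omega

/-- Hypothesis `hstep`: a round accepts with probability `a`, and an accepted proposal has law `ν`.
Then `n` rounds end with a sample of `ν` with probability `1 - (1 - a) ^ n`, and leave register `0`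
unchanged otherwise. The test function need only be a function of register `0` up to time `T`. -/
theorem lintegral_rejectionLoop (scale m : ℝ) (hsamp : samp.Samples μ Ts)
    (hev : ev.Computes (fun z => S z.2 z.1) Te) (hdens : dens.Computes (fun z => f z.1) Te)
    (hS : ∀ x, Measurable fun y => S y x) (hf : Measurable f) {x a : ℝ} {ν : Measure ℝ}
    [IsProbabilityMeasure ν] (ha : 0 ≤ a) (ha1 : a ≤ 1)
    (hstep : ∀ (H : ℝ → ℝ≥0∞) (r : ℝ), Measurable H →
      ∫⁻ t, ∫⁻ u, H (rejectionUpdate S f scale m x r t u) ∂unifMeasure ∂μ =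
        ENNReal.ofReal (1 - a) * H r + ENNReal.ofReal a * ∫⁻ y, H y ∂ν)
    {Φ : MState → ℝ≥0∞} (hΦ : Measurable Φ) {H : ℝ → ℝ≥0∞} (hH : Measurable H) {T : ℕ}
    (hT : ∀ s : MState, s.2 ≤ T → Φ s = H (s.1 0)) (n : ℕ) (s : MState) (h1 : s.1 1 = n)
    (h2 : s.1 2 = x) (h9 : s.1 9 = 0) (hs : s.2 + n * (16 + Ts + 2 * Te) + 1 ≤ T) :
    ∫⁻ s', Φ s' ∂(loop 1 (rejectionStep samp ev dens scale m)).sem s =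
      ENNReal.ofReal ((1 - a) ^ n) * H (s.1 0) +
        ENNReal.ofReal (1 - (1 - a) ^ n) * ∫⁻ y, H y ∂ν := by
  induction n generalizing s with
  | zero =>
    rw [lintegral_loop _ _ _ hΦ, if_neg (by simp [h1]), hT _ (by simp at hs ⊢; omega)]
    simp
  | succ n ih =>
    rw [lintegral_loop _ _ _ hΦ, if_pos (by rw [h1]; positivity)]
    rw [lintegral_rejectionStep scale m hsamp hev hdens hS hf (s.1, s.2 + 1) h9
      (Φ := fun s' => ∫⁻ s'', Φ s'' ∂(loop 1 (rejectionStep samp ev dens scale m)).sem s')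
      hΦ.lintegral_kernel
      (H := fun r => ENNReal.ofReal ((1 - a) ^ n) * H r +
        ENNReal.ofReal (1 - (1 - a) ^ n) * ∫⁻ y, H y ∂ν) (by fun_prop)]
    · have hq0 : 0 ≤ 1 - a := by linarith
      have hq1 : (1 - a) ^ n ≤ 1 := pow_le_one₀ hq0 (by linarith)
      have hqn : 0 ≤ (1 - a) ^ n := pow_nonneg hq0 n
      dsimp only
      rw [h2, hstep (fun r => ENNReal.ofReal ((1 - a) ^ n) * H r +
        ENNReal.ofReal (1 - (1 - a) ^ n) * ∫⁻ y, H y ∂ν) _ (by fun_prop), lintegral_add_right _ measurable_const,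
        lintegral_const_mul _ hH, lintegral_const, measure_univ, mul_one, pow_succ']
      have e1 : ENNReal.ofReal ((1 - a) * (1 - a) ^ n) =
          ENNReal.ofReal (1 - a) * ENNReal.ofReal ((1 - a) ^ n) := ENNReal.ofReal_mul hq0
      have e2 : ENNReal.ofReal (1 - (1 - a) * (1 - a) ^ n) =
          ENNReal.ofReal (1 - a) * ENNReal.ofReal (1 - (1 - a) ^ n) +
          ENNReal.ofReal a * (ENNReal.ofReal ((1 - a) ^ n) + ENNReal.ofReal (1 - (1 - a) ^ n)) := by
        rw [← ENNReal.ofReal_add hqn (by linarith), ← ENNReal.ofReal_mul hq0,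
          ← ENNReal.ofReal_mul ha, ← ENNReal.ofReal_add (mul_nonneg hq0 (by linarith))
            (mul_nonneg ha (by linarith))]
        congr 1; ring
      rw [e1, e2]
      ring
    · intro s' h1' h2' h9' hs'
      refine ih s' ?_ (h2'.trans h2) h9' ?_
      · rw [h1']; simp [h1]
      · simp only at hs'
        have : (n + 1) * (16 + Ts + 2 * Te) = n * (16 + Ts + 2 * Te) + (16 + Ts + 2 * Te) := by ring
        omega

theorem lintegral_rejectionSampler (scale m : ℝ) (hsamp : samp.Samples μ Ts)
    (hev : ev.Computes (fun z => S z.2 z.1) Te) (hdens : dens.Computes (fun z => f z.1) Te)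
    (hS : ∀ x, Measurable fun y => S y x) (hf : Measurable f) {x a : ℝ} {ν : Measure ℝ}
    [IsProbabilityMeasure ν] (ha : 0 ≤ a) (ha1 : a ≤ 1)
    (hstep : ∀ (H : ℝ → ℝ≥0∞) (r : ℝ), Measurable H →
      ∫⁻ t, ∫⁻ u, H (rejectionUpdate S f scale m x r t u) ∂unifMeasure ∂μ =
        ENNReal.ofReal (1 - a) * H r + ENNReal.ofReal a * ∫⁻ y, H y ∂ν)
    {Φ : MState → ℝ≥0∞} (hΦ : Measurable Φ) {H : ℝ → ℝ≥0∞} (hH : Measurable H) (n : ℕ)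
    (hT : ∀ s : MState, s.2 ≤ n * (16 + Ts + 2 * Te) + 2 → Φ s = H (s.1 0)) :
    ∫⁻ s', Φ s' ∂(rejectionSampler samp ev dens scale m).sem (initState (x, n)) =
      ENNReal.ofReal ((1 - a) ^ n) * H x + ENNReal.ofReal (1 - (1 - a) ^ n) * ∫⁻ y, H y ∂ν := by
  rw [rejectionSampler, sem_seq_arith,
    lintegral_rejectionLoop scale m hsamp hev hdens hS hf (x := x) ha ha1 hstep hΦ hH hT n]
  · simp [write, initState]
  · simp [write, initState]
  · simp [write, initState, Arith.apply]
  · simp [write, initState]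
  · simp only [write, initState]; omega

theorem haltsWithin_rejectionSampler (scale m : ℝ) (hsamp : samp.Samples μ Ts)
    (hev : ev.Computes (fun z => S z.2 z.1) Te) (hdens : dens.Computes (fun z => f z.1) Te)
    (hS : ∀ x, Measurable fun y => S y x) (hf : Measurable f) {x a : ℝ} {ν : Measure ℝ}
    [IsProbabilityMeasure ν] (ha : 0 ≤ a) (ha1 : a ≤ 1)
    (hstep : ∀ (H : ℝ → ℝ≥0∞) (r : ℝ), Measurable H →
      ∫⁻ t, ∫⁻ u, H (rejectionUpdate S f scale m x r t u) ∂unifMeasure ∂μ =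
        ENNReal.ofReal (1 - a) * H r + ENNReal.ofReal a * ∫⁻ y, H y ∂ν) (n : ℕ) :
    (rejectionSampler samp ev dens scale m).HaltsWithin (x, n)
      (n * (16 + Ts + 2 * Te) + 2) := by
  have hq0 : 0 ≤ 1 - a := by linarith
  have hq1 : (1 - a) ^ n ≤ 1 := pow_le_one₀ hq0 (by linarith)
  have hsum : ENNReal.ofReal ((1 - a) ^ n) + ENNReal.ofReal (1 - (1 - a) ^ n) = 1 := by
    rw [← ENNReal.ofReal_add (pow_nonneg hq0 n) (by linarith)]; simp
  have hm : Measurable fun s : MState => (s.1 0, s.2) := (measurable_reg 0).prodMk measurable_snd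
  have h1 := lintegral_rejectionSampler scale m hsamp hev hdens hS hf ha ha1 hstep
    (Φ := fun _ => 1) measurable_const (H := fun _ => 1) measurable_const n fun _ _ => rfl
  have hset : MeasurableSet {s : MState | ¬ s.2 ≤ n * (16 + Ts + 2 * Te) + 2} :=
    (measurableSet_le measurable_snd measurable_const).compl
  have h2 := lintegral_rejectionSampler scale m hsamp hev hdens hS hf ha ha1 hstep
    (Φ := Set.indicator {s : MState | ¬ s.2 ≤ n * (16 + Ts + 2 * Te) + 2} fun _ => 1)
    (measurable_const.indicator hset) (H := fun _ => 0) measurable_const n fun s hs => by simp [hs]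
  constructor
  · rw [run_apply, Measure.map_apply hm .univ, Set.preimage_univ]
    simpa [hsum] using h1
  · rw [run_apply, ae_map_iff hm.aemeasurable
      (measurableSet_le measurable_snd measurable_const)]
    rw [lintegral_indicator hset] at h2
    simpa [ae_iff] using h2

end

end Cmd

/-! ### Derivatives of `exp (-ψ)` -/

theorem derivSum_nonneg (ψ : ℝ → ℝ) (n : ℕ) {r : ℝ} (hr : 0 < r) (t : ℝ) :
    0 ≤ derivSum ψ n r t :=
  Finset.sum_nonneg fun _ _ => by positivity

theorem continuous_derivSum {ψ : ℝ → ℝ} (hψ : ContDiff ℝ (⊤ : ℕ∞) ψ) (n : ℕ) (r : ℝ) :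
    Continuous (derivSum ψ n r) := by
  unfold derivSum
  refine continuous_finsetSum _ fun j _ => ?_
  exact ((hψ.continuous_iteratedDeriv j (by exact_mod_cast le_top)).abs).div_const _

theorem measurableSet_goodSet {ψ : ℝ → ℝ} (hψ : ContDiff ℝ (⊤ : ℕ∞) ψ) (n : ℕ) (r : ℝ) :
    MeasurableSet (goodSet ψ n r) :=
  measurableSet_le (continuous_derivSum hψ n r).measurable measurable_const

/-- A crude Faà di Bruno bound for `exp ∘ (-ψ)`. Up to the factor `n! r ^ n exp (-ψ)`, Leibniz' rule
for `(exp (-ψ))' = -ψ' exp (-ψ)` bounds the next derivative by `derivSum` times the largest of the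
preceding ones. -/
theorem abs_iteratedDeriv_exp_neg_le {ψ : ℝ → ℝ} (hψ : ContDiff ℝ (⊤ : ℕ∞) ψ) {r : ℝ} (hr : 0 < r)
    {m : ℕ} (t : ℝ) {n : ℕ} (hn : n ≤ m) :
    |iteratedDeriv n (fun t => Real.exp (-ψ t)) t| ≤
      n ! * r ^ n * Real.exp (-ψ t) * max 1 (derivSum ψ m r t) ^ n := by
  set f : ℝ → ℝ := fun t => Real.exp (-ψ t) with hf
  set E := max 1 (derivSum ψ m r t) with hE
  have hE1 : 1 ≤ E := le_max_left _ _
  have hfs : ContDiff ℝ (⊤ : ℕ∞) f := hψ.neg.exp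
  have hdψ : ContDiff ℝ (⊤ : ℕ∞) (deriv ψ) := (contDiff_infty_iff_deriv.1 hψ).2
  have hdiff : Differentiable ℝ ψ := (contDiff_infty_iff_deriv.1 hψ).1
  have hderiv : deriv f = (fun t => -deriv ψ t) * f := by
    ext u
    have := ((hdiff u).hasDerivAt.neg.exp).deriv
    simp only [Pi.mul_apply]
    rw [hf]
    refine Eq.trans this ?_
    simp only [Pi.neg_apply]; ring
  induction n using Nat.strong_induction_on with
  | _ n ih =>
    rcases n with _ | n
    · simp [hf, abs_of_pos (Real.exp_pos _)]
    have hfac : (0 : ℝ) < (n + 1)! := by positivity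
    rw [iteratedDeriv_succ', hderiv, iteratedDeriv_mul
      (hdψ.neg.contDiffAt.of_le (by exact_mod_cast le_top))
      (hfs.contDiffAt.of_le (by exact_mod_cast le_top))]
    have hterm : ∀ i ∈ Finset.range (n + 1),
        |(n.choose i : ℝ) * iteratedDeriv i (fun t => -deriv ψ t) t * iteratedDeriv (n - i) f t| ≤
          ((n + 1)! * r ^ (n + 1) * f t * E ^ n) *
            (|iteratedDeriv (i + 1) ψ t| / (r ^ (i + 1) * ((i + 1)! : ℝ))) := by
      intro i hi
      have hin : i ≤ n := by simpa [Nat.lt_succ_iff] using hi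
      have h1 : iteratedDeriv i (fun t => -deriv ψ t) t = -iteratedDeriv (i + 1) ψ t := by
        rw [iteratedDeriv_succ', ← iteratedDeriv_neg]; rfl
      have hEp : E ^ (n - i) ≤ E ^ n := pow_le_pow_right₀ hE1 (Nat.sub_le _ _)
      have hih := ih (n - i) (by omega) (by omega)
      have hch : (n.choose i : ℝ) * (n - i)! * (i + 1)! ≤ (n + 1)! := by
        have : n.choose i * (n - i)! * (i + 1)! ≤ (n + 1)! := by
          rw [Nat.factorial_succ i, Nat.factorial_succ n, ← Nat.choose_mul_factorial_mul_factorial hin]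
          calc n.choose i * (n - i)! * ((i + 1) * i !)
              = (i + 1) * (n.choose i * i ! * (n - i)!) := by ring
            _ ≤ _ := Nat.mul_le_mul_right _ (by omega)
        exact_mod_cast this
      have hr1 : r ^ (n + 1) = r ^ (n - i) * r ^ (i + 1) := by
        rw [← pow_add]; congr 1; omega
      rw [h1, abs_mul, abs_mul, abs_neg, Nat.abs_cast]
      calc (n.choose i : ℝ) * |iteratedDeriv (i + 1) ψ t| * |iteratedDeriv (n - i) f t|
          ≤ n.choose i * |iteratedDeriv (i + 1) ψ t| *
              ((n - i)! * r ^ (n - i) * f t * E ^ n) := by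
            have : (0 : ℝ) ≤ (n - i)! * r ^ (n - i) * f t := by
              have := (Real.exp_pos (-ψ t)).le
              positivity
            gcongr
            exact hih.trans (by gcongr)
        _ = (n.choose i * (n - i)! * (i + 1)!) * (r ^ (n + 1) * f t * E ^ n *
              (|iteratedDeriv (i + 1) ψ t| / (r ^ (i + 1) * ((i + 1)! : ℝ)))) := by
            rw [hr1]; field_simp
        _ ≤ (n + 1)! * (r ^ (n + 1) * f t * E ^ n *
              (|iteratedDeriv (i + 1) ψ t| / (r ^ (i + 1) * ((i + 1)! : ℝ)))) := by
            have := (Real.exp_pos (-ψ t)).le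
            gcongr
        _ = _ := by ring
    have hsum : ∑ i ∈ Finset.range (n + 1),
        |iteratedDeriv (i + 1) ψ t| / (r ^ (i + 1) * ((i + 1)! : ℝ)) ≤ E := by
      refine le_trans ?_ (le_max_right 1 (derivSum ψ m r t))
      rw [derivSum, Finset.range_eq_Ico, Finset.sum_Ico_add'
        (fun j => |iteratedDeriv j ψ t| / (r ^ j * (j ! : ℝ))) 0 (n + 1) 1]
      refine Finset.sum_le_sum_of_subset_of_nonneg (fun j hj => ?_) fun _ _ _ => by positivity
      simp only [Finset.mem_Ico, Finset.mem_Icc] at hj ⊢; omega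
    refine (Finset.abs_sum_le_sum_abs _ _).trans ((Finset.sum_le_sum hterm).trans ?_)
    rw [← Finset.mul_sum, pow_succ E n]
    have := (Real.exp_pos (-ψ t)).le
    calc _ ≤ ((n + 1)! * r ^ (n + 1) * f t * E ^ n) * E := by gcongr
      _ = _ := by ring

namespace RegularNegLogDensity

variable {ψ : ℝ → ℝ} {C : ℕ} {Ct : ℝ}

theorem contDiff_exp_neg (h : RegularNegLogDensity ψ C Ct) :
    ContDiff ℝ (⊤ : ℕ∞) (fun t => Real.exp (-ψ t)) := h.smooth.neg.exp

theorem continuous_iteratedDeriv_exp_neg (h : RegularNegLogDensity ψ C Ct) (n : ℕ) :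
    Continuous (iteratedDeriv n fun t => Real.exp (-ψ t)) :=
  h.contDiff_exp_neg.continuous_iteratedDeriv n (by exact_mod_cast le_top)

theorem integrable_exp_neg (h : RegularNegLogDensity ψ C Ct) :
    Integrable (fun t => Real.exp (-ψ t)) := by
  by_contra hc
  have := h.integral_eq_one
  rw [integral_undef hc] at this
  exact zero_ne_one this

theorem lintegral_exp_neg (h : RegularNegLogDensity ψ C Ct) :
    ∫⁻ t, ENNReal.ofReal (Real.exp (-ψ t)) = 1 := by
  rw [← ofReal_integral_eq_lintegral_ofReal h.integrable_exp_neg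
    (.of_forall fun _ => (Real.exp_pos _).le), h.integral_eq_one, ENNReal.ofReal_one]

theorem integrable_iteratedDeriv_exp_neg (h : RegularNegLogDensity ψ C Ct) (n : ℕ) :
    Integrable (iteratedDeriv n fun t => Real.exp (-ψ t)) := by
  rcases Nat.eq_zero_or_pos n with rfl | hn
  · simpa using h.integrable_exp_neg
  have hm := (h.moment n hn n (Finset.mem_Icc.2 ⟨hn, le_rfl⟩)).1
  refine ((h.integrable_exp_neg.add hm).const_mul (n ! * Ct ^ n)).mono'
    (h.continuous_iteratedDeriv_exp_neg n).aestronglyMeasurable (.of_forall fun t => ?_)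
  refine (abs_iteratedDeriv_exp_neg_le h.smooth h.const_pos t (le_refl n)).trans ?_
  have hD := derivSum_nonneg ψ n h.const_pos t
  have hmax : max 1 (derivSum ψ n Ct t) ^ n ≤ 1 + derivSum ψ n Ct t ^ n := by
    rcases max_cases 1 (derivSum ψ n Ct t) with ⟨he, _⟩ | ⟨he, _⟩ <;> rw [he]
    · simp; positivity
    · linarith
  have := (Real.exp_pos (-ψ t)).le
  have := h.const_pos
  calc _ ≤ n ! * Ct ^ n * Real.exp (-ψ t) * (1 + derivSum ψ n Ct t ^ n) := by gcongr
    _ = _ := by simp only [Pi.add_apply]; ring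

theorem integral_iteratedDeriv_exp_neg (h : RegularNegLogDensity ψ C Ct) {n : ℕ} (hn : n ≠ 0) :
    ∫ t, iteratedDeriv n (fun t => Real.exp (-ψ t)) t = 0 := by
  obtain ⟨m, rfl⟩ := Nat.exists_eq_succ_of_ne_zero hn
  refine integral_eq_zero_of_hasDerivAt_of_integrable (fun t => ?_)
    (h.integrable_iteratedDeriv_exp_neg (m + 1)) (h.integrable_iteratedDeriv_exp_neg m)
  rw [iteratedDeriv_succ]
  exact (h.contDiff_exp_neg.differentiable_iteratedDeriv m
    (by exact_mod_cast ENat.natCast_lt_top m) t).hasDerivAt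

/-- Off the good set the derivatives of `exp (-ψ)` are controlled by the error term. -/
theorem setLIntegral_abs_iteratedDeriv_le (h : RegularNegLogDensity ψ C Ct) {lam : ℝ}
    (hlam : 0 < lam) {n m : ℕ} (hn : 1 ≤ n) (hnm : n ≤ m) :
    ∫⁻ t in (goodSet ψ m lam)ᶜ, ENNReal.ofReal |iteratedDeriv n (fun t => Real.exp (-ψ t)) t| ≤
      ENNReal.ofReal (n ! * lam ^ n) * errTerm ψ m lam := by
  have hle : ∫⁻ t in (goodSet ψ m lam)ᶜ,
      ENNReal.ofReal (Real.exp (-ψ t) * derivSum ψ m lam t ^ n) ≤ errTerm ψ m lam :=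
    (le_iSup₂ (f := fun k (_ : k ∈ Finset.Icc 1 m) => ∫⁻ t in (goodSet ψ m lam)ᶜ,
      ENNReal.ofReal (Real.exp (-ψ t) * derivSum ψ m lam t ^ k)) n
      (Finset.mem_Icc.2 ⟨hn, hnm⟩)).trans le_add_self
  refine le_trans ?_ (mul_le_mul_right hle _)
  rw [← lintegral_const_mul' _ _ ENNReal.ofReal_ne_top]
  refine setLIntegral_mono' (measurableSet_goodSet h.smooth m lam).compl fun t ht => ?_
  rw [← ENNReal.ofReal_mul (by positivity)]
  refine ENNReal.ofReal_le_ofReal ?_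
  have hD : 1 ≤ derivSum ψ m lam t := le_of_lt (not_le.1 fun h' => ht h')
  have := abs_iteratedDeriv_exp_neg_le h.smooth hlam t hnm
  rw [max_eq_right hD] at this
  linarith

theorem lintegral_abs_iteratedDeriv_le (h : RegularNegLogDensity ψ C Ct) {lam : ℝ}
    (hlam : 0 < lam) {n m : ℕ} (hn : 1 ≤ n) (hnm : n ≤ m) :
    ∫⁻ t, ENNReal.ofReal |iteratedDeriv n (fun t => Real.exp (-ψ t)) t| ≤
      ENNReal.ofReal (n ! * lam ^ n) * (1 + errTerm ψ m lam) := by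
  rw [← lintegral_add_compl _ (measurableSet_goodSet h.smooth m lam), mul_add]
  refine add_le_add ?_ (h.setLIntegral_abs_iteratedDeriv_le hlam hn hnm)
  rw [← h.lintegral_exp_neg, ← lintegral_const_mul' _ _ ENNReal.ofReal_ne_top]
  refine le_trans ?_ (setLIntegral_le_lintegral (goodSet ψ m lam) _)
  refine setLIntegral_mono' (measurableSet_goodSet h.smooth m lam) fun t ht => ?_
  rw [← ENNReal.ofReal_mul (by positivity)]
  refine ENNReal.ofReal_le_ofReal ?_
  have := abs_iteratedDeriv_exp_neg_le h.smooth hlam t hnm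
  rw [max_eq_left ht] at this
  simpa using this

end RegularNegLogDensity

/-! ### The truncated signed kernel at unit scale -/

/-- The truncated backward heat operator `∑_{k ≤ N} (-1)^k s^{2k} / (2k)!! * F^{(2k)}`. -/
noncomputable def backwardHeat (s : ℝ) (N : ℕ) (F : ℝ → ℝ) (t : ℝ) : ℝ :=
  ∑ k ∈ Finset.range (N + 1),
    (-1) ^ k * s ^ (2 * k) / ((2 * k)‼ : ℝ) * iteratedDeriv (2 * k) F t

theorem backwardHeat_eq_add (s : ℝ) (N : ℕ) (F : ℝ → ℝ) (t : ℝ) :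
    backwardHeat s N F t = F t + ∑ k ∈ Finset.Icc 1 N,
      (-1) ^ k * s ^ (2 * k) / ((2 * k)‼ : ℝ) * iteratedDeriv (2 * k) F t := by
  rw [backwardHeat, Finset.range_eq_Ico, Finset.sum_eq_sum_Ico_succ_bot (Nat.succ_pos N)]
  simp [Finset.Ico_add_one_right_eq_Icc]

theorem signedKernel_targetDensity {ψ : ℝ → ℝ} (hψ : ContDiff ℝ (⊤ : ℕ∞) ψ) {τ : ℝ} (σ : ℝ)
    (N : ℕ) (y x : ℝ) :
    signedKernel (targetDensity ψ τ) σ N y x =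
      1 / τ * backwardHeat (σ / τ) N (fun t => Real.exp (-ψ t)) ((y - x) / τ) := by
  rw [signedKernel, backwardHeat, Finset.mul_sum]
  refine Finset.sum_congr rfl fun k _ => ?_
  have h1 : (fun θ => targetDensity ψ τ y θ) =
      fun θ => (fun z => 1 / τ * (fun t => Real.exp (-ψ t)) (τ⁻¹ * z)) (y - θ) := by
    ext θ; simp [targetDensity, div_eq_inv_mul]
  have h2 : ContDiff ℝ (2 * k : ℕ) (fun t => Real.exp (-ψ t)) :=
    contDiff_infty.1 hψ.neg.exp _
  rw [h1, congrFun (iteratedDeriv_comp_const_sub (2 * k)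
    (fun z => 1 / τ * (fun t => Real.exp (-ψ t)) (τ⁻¹ * z)) y) x, iteratedDeriv_const_mul_field,
    iteratedDeriv_comp_const_mul h2]
  simp only [even_two_mul, Even.neg_one_pow, one_smul, div_pow, ← div_eq_inv_mul]
  ring

theorem sum_Icc_pow_le_half (N : ℕ) : ∑ k ∈ Finset.Icc 1 N, (1 / 64 : ℝ) ^ k ≤ 1 / 2 := by
  have h : ∑ k ∈ Finset.Icc 1 N, (1 / 64 : ℝ) ^ k = (1 - (1 / 64) ^ N) / 63 := by
    induction N with
    | zero => simp
    | succ n ih => rw [Finset.sum_Icc_succ_top (by omega), ih]; ring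
  rw [h]
  have : (0 : ℝ) ≤ (1 / 64) ^ N := by positivity
  linarith

/-- Bound for the coefficients of the backward heat operator. Already the crude bound
`(2k)! ≤ (2N)^{2k}` suffices. -/
theorem pow_mul_factorial_mul_pow_le {s lam : ℝ} {N k : ℕ} (hs : 0 ≤ s) (hlam : 0 ≤ lam)
    (hsl : s * lam * (2 * N) ≤ 1 / 8) (hk : k ≤ N) :
    s ^ (2 * k) * ((2 * k)! * lam ^ (2 * k)) ≤ (1 / 64) ^ k := by
  have h1 : ((2 * k)! : ℝ) ≤ (2 * N) ^ (2 * k) := by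
    have : (2 * k)! ≤ (2 * N) ^ (2 * k) :=
      (Nat.factorial_le_pow _).trans (Nat.pow_le_pow_left (by omega) _)
    exact_mod_cast this
  calc s ^ (2 * k) * ((2 * k)! * lam ^ (2 * k))
      ≤ s ^ (2 * k) * ((2 * N) ^ (2 * k) * lam ^ (2 * k)) := by gcongr
    _ = (s * lam * (2 * N)) ^ (2 * k) := by rw [← mul_pow, ← mul_pow]; ring
    _ ≤ (1 / 8) ^ (2 * k) := by gcongr
    _ = _ := by rw [pow_mul]; norm_num

theorem coeff_le {s lam : ℝ} {N k : ℕ} (hs : 0 ≤ s) (hlam : 0 ≤ lam)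
    (hsl : s * lam * (2 * N) ≤ 1 / 8) (hk : k ≤ N) :
    s ^ (2 * k) / ((2 * k)‼ : ℝ) * ((2 * k)! * lam ^ (2 * k)) ≤ (1 / 64) ^ k := by
  refine le_trans ?_ (pow_mul_factorial_mul_pow_le hs hlam hsl hk)
  gcongr
  exact div_le_self (by positivity) (by exact_mod_cast Nat.doubleFactorial_pos _)

theorem abs_coeff (s : ℝ) (k : ℕ) (a : ℝ) :
    |(-1) ^ k * s ^ (2 * k) / ((2 * k)‼ : ℝ) * a| = s ^ (2 * k) / ((2 * k)‼ : ℝ) * |a| := by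
  rw [abs_mul, abs_div, abs_mul, abs_pow, abs_neg, abs_one, one_pow, one_mul,
    abs_of_nonneg (by rw [pow_mul]; positivity), Nat.abs_cast]

namespace RegularNegLogDensity

variable {ψ : ℝ → ℝ} {C : ℕ} {Ct : ℝ} {s lam : ℝ} {N : ℕ}

theorem continuous_backwardHeat (h : RegularNegLogDensity ψ C Ct) (s : ℝ) (N : ℕ) :
    Continuous (backwardHeat s N fun t => Real.exp (-ψ t)) := by
  unfold backwardHeat
  exact continuous_finsetSum _ fun k _ => (h.continuous_iteratedDeriv_exp_neg _).const_mul _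

theorem integrable_backwardHeat (h : RegularNegLogDensity ψ C Ct) (s : ℝ) (N : ℕ) :
    Integrable (backwardHeat s N fun t => Real.exp (-ψ t)) := by
  unfold backwardHeat
  exact integrable_finsetSum _ fun k _ => (h.integrable_iteratedDeriv_exp_neg _).const_mul _

theorem integral_backwardHeat (h : RegularNegLogDensity ψ C Ct) (s : ℝ) (N : ℕ) :
    ∫ t, backwardHeat s N (fun t => Real.exp (-ψ t)) t = 1 := by
  simp_rw [backwardHeat_eq_add]
  rw [integral_add h.integrable_exp_neg (integrable_finsetSum _ fun k _ =>
    (h.integrable_iteratedDeriv_exp_neg _).const_mul _), h.integral_eq_one,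
    integral_finsetSum _ fun k _ => (h.integrable_iteratedDeriv_exp_neg _).const_mul _]
  rw [Finset.sum_eq_zero, add_zero]
  intro k hk
  rw [integral_const_mul, h.integral_iteratedDeriv_exp_neg, mul_zero]
  have := (Finset.mem_Icc.1 hk).1
  omega

theorem abs_coeff_mul_iteratedDeriv_le (h : RegularNegLogDensity ψ C Ct) (hs : 0 ≤ s)
    (hlam : 0 < lam) (hsl : s * lam * (2 * N) ≤ 1 / 8) {k : ℕ} (hk : k ≤ N) (t : ℝ) :
    |(-1) ^ k * s ^ (2 * k) / ((2 * k)‼ : ℝ) *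
        iteratedDeriv (2 * k) (fun t => Real.exp (-ψ t)) t| ≤
      (1 / 64) ^ k * (Real.exp (-ψ t) * max 1 (derivSum ψ (2 * N) lam t) ^ (2 * k)) := by
  rw [abs_coeff]
  have hb := abs_iteratedDeriv_exp_neg_le h.smooth hlam t (show 2 * k ≤ 2 * N by omega)
  have hE := (Real.exp_pos (-ψ t)).le
  have hM : 0 ≤ max 1 (derivSum ψ (2 * N) lam t) := le_max_of_le_left zero_le_one
  calc _ ≤ s ^ (2 * k) / ((2 * k)‼ : ℝ) * ((2 * k)! * lam ^ (2 * k) * Real.exp (-ψ t) *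
            max 1 (derivSum ψ (2 * N) lam t) ^ (2 * k)) := by gcongr
    _ = (s ^ (2 * k) / ((2 * k)‼ : ℝ) * ((2 * k)! * lam ^ (2 * k))) * (Real.exp (-ψ t) *
            max 1 (derivSum ψ (2 * N) lam t) ^ (2 * k)) := by ring
    _ ≤ _ := by
      gcongr
      exact coeff_le hs hlam.le hsl hk

/-- On the good set the term `k = 0` dominates. -/
theorem backwardHeat_nonneg (h : RegularNegLogDensity ψ C Ct) (hs : 0 ≤ s)
    (hlam : 0 < lam) (hsl : s * lam * (2 * N) ≤ 1 / 8) {t : ℝ} (ht : t ∈ goodSet ψ (2 * N) lam) :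
    0 ≤ backwardHeat s N (fun t => Real.exp (-ψ t)) t := by
  rw [backwardHeat_eq_add]
  have hE := (Real.exp_pos (-ψ t)).le
  have h1 : |∑ k ∈ Finset.Icc 1 N, (-1) ^ k * s ^ (2 * k) / ((2 * k)‼ : ℝ) *
      iteratedDeriv (2 * k) (fun t => Real.exp (-ψ t)) t| ≤ 1 / 2 * Real.exp (-ψ t) := by
    refine (Finset.abs_sum_le_sum_abs _ _).trans ((Finset.sum_le_sum fun k hk =>
      h.abs_coeff_mul_iteratedDeriv_le hs hlam hsl (Finset.mem_Icc.1 hk).2 t).trans ?_)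
    simp only [max_eq_left (show derivSum ψ (2 * N) lam t ≤ 1 from ht), one_pow, mul_one]
    rw [← Finset.sum_mul]
    gcongr
    exact sum_Icc_pow_le_half N
  have := (abs_le.1 h1).1
  linarith

/-- The mass of the negative part of the signed kernel. -/
theorem lintegral_neg_backwardHeat_le (h : RegularNegLogDensity ψ C Ct) (hs : 0 ≤ s)
    (hlam : 0 < lam) (hsl : s * lam * (2 * N) ≤ 1 / 8) :
    ∫⁻ t, ENNReal.ofReal (-backwardHeat s N (fun t => Real.exp (-ψ t)) t) ≤
      ENNReal.ofReal (1 / 2) * errTerm ψ (2 * N) lam := by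
  have hA := measurableSet_goodSet h.smooth (2 * N) lam
  rw [← lintegral_add_compl _ hA, setLIntegral_congr_fun hA (g := fun _ => 0) fun t ht => ?_,
    lintegral_zero, zero_add]
  swap
  · exact ENNReal.ofReal_of_nonpos (by linarith [h.backwardHeat_nonneg hs hlam hsl ht])
  calc _ ≤ ∫⁻ t in (goodSet ψ (2 * N) lam)ᶜ, ∑ k ∈ Finset.Icc 1 N,
        ENNReal.ofReal (s ^ (2 * k) / ((2 * k)‼ : ℝ)) *
          ENNReal.ofReal |iteratedDeriv (2 * k) (fun t => Real.exp (-ψ t)) t| := by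
        refine lintegral_mono fun t => ?_
        have hc : ∀ k : ℕ, 0 ≤ s ^ (2 * k) / ((2 * k)‼ : ℝ) := fun k => by positivity
        simp_rw [← ENNReal.ofReal_mul (hc _)]
        rw [← ENNReal.ofReal_sum_of_nonneg fun k _ => mul_nonneg (hc k) (abs_nonneg _)]
        refine ENNReal.ofReal_le_ofReal ?_
        rw [backwardHeat_eq_add]
        have := Finset.abs_sum_le_sum_abs (fun k => (-1) ^ k * s ^ (2 * k) / ((2 * k)‼ : ℝ) *
          iteratedDeriv (2 * k) (fun t => Real.exp (-ψ t)) t) (Finset.Icc 1 N)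
        simp only [abs_coeff] at this
        have h2 := neg_le_of_abs_le this
        have hE := (Real.exp_pos (-ψ t)).le
        linarith
    _ = ∑ k ∈ Finset.Icc 1 N, ENNReal.ofReal (s ^ (2 * k) / ((2 * k)‼ : ℝ)) *
          ∫⁻ t in (goodSet ψ (2 * N) lam)ᶜ,
            ENNReal.ofReal |iteratedDeriv (2 * k) (fun t => Real.exp (-ψ t)) t| := by
        rw [lintegral_finsetSum' _ fun k _ => ?_]
        · simp_rw [lintegral_const_mul' _ _ ENNReal.ofReal_ne_top]
        · exact ((h.continuous_iteratedDeriv_exp_neg (2 * k)).abs.measurable.ennreal_ofReal.const_mul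
            _).aemeasurable
    _ ≤ ∑ k ∈ Finset.Icc 1 N, ENNReal.ofReal ((1 / 64) ^ k) * errTerm ψ (2 * N) lam := by
        refine Finset.sum_le_sum fun k hk => ?_
        obtain ⟨hk1, hk2⟩ := Finset.mem_Icc.1 hk
        refine (mul_le_mul_right (h.setLIntegral_abs_iteratedDeriv_le hlam
          (show 1 ≤ 2 * k by omega) (show 2 * k ≤ 2 * N by omega)) _).trans ?_
        rw [← mul_assoc, ← ENNReal.ofReal_mul (by positivity)]
        gcongr
        exact coeff_le hs hlam.le hsl hk2
    _ ≤ _ := by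
        rw [← Finset.sum_mul, ← ENNReal.ofReal_sum_of_nonneg fun k _ => by positivity]
        gcongr
        exact sum_Icc_pow_le_half N

/-- Domination of the signed kernel by the proposal density of the rejection sampler. -/
theorem exp_mul_backwardHeat_le (h : RegularNegLogDensity ψ C Ct) (hs : 0 ≤ s)
    (hlam : 0 < lam) (hsl : s * lam * (2 * N) ≤ 1 / 8) (hN : 1 ≤ N)
    (hM : ratioBound ψ (2 * N) lam ≠ ⊤) (t : ℝ) :
    Real.exp (ψ (t / 2)) * backwardHeat s N (fun t => Real.exp (-ψ t)) t ≤
      2 * (ratioBound ψ (2 * N) lam).toReal := by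
  set M := (ratioBound ψ (2 * N) lam).toReal with hMdef
  have hD := derivSum_nonneg ψ (2 * N) hlam t
  have hb : ∀ k, 1 ≤ k → k ≤ 2 * N →
      Real.exp (-ψ t + ψ (t / 2)) * (1 + derivSum ψ (2 * N) lam t ^ k) ≤ M := by
    intro k h1 h2
    rw [hMdef, ← ENNReal.ofReal_le_iff_le_toReal hM]
    exact (le_iSup (fun t : ℝ => ENNReal.ofReal (Real.exp (-ψ t + ψ (t / 2)) *
      (1 + derivSum ψ (2 * N) lam t ^ k))) t).trans
      (le_iSup₂ (f := fun k (_ : k ∈ Finset.Icc 1 (2 * N)) => ⨆ t : ℝ, ENNReal.ofReal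
        (Real.exp (-ψ t + ψ (t / 2)) * (1 + derivSum ψ (2 * N) lam t ^ k))) k
        (Finset.mem_Icc.2 ⟨h1, h2⟩))
  have hM0 : 0 ≤ M := ENNReal.toReal_nonneg
  have hexp : Real.exp (-ψ t + ψ (t / 2)) = Real.exp (ψ (t / 2)) * Real.exp (-ψ t) := by
    rw [← Real.exp_add]; ring_nf
  have h0 : Real.exp (ψ (t / 2)) * Real.exp (-ψ t) ≤ M := by
    rw [← hexp]
    refine le_trans ?_ (hb 1 le_rfl (by omega))
    exact le_mul_of_one_le_right (Real.exp_pos _).le (by rw [pow_one]; linarith)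
  have hterm : ∀ k ∈ Finset.Icc 1 N, Real.exp (ψ (t / 2)) * ((-1) ^ k * s ^ (2 * k) /
      ((2 * k)‼ : ℝ) * iteratedDeriv (2 * k) (fun t => Real.exp (-ψ t)) t) ≤ (1 / 64) ^ k * M := by
    intro k hk
    obtain ⟨hk1, hk2⟩ := Finset.mem_Icc.1 hk
    have hmax : max 1 (derivSum ψ (2 * N) lam t) ^ (2 * k) ≤
        1 + derivSum ψ (2 * N) lam t ^ (2 * k) := by
      rcases max_cases 1 (derivSum ψ (2 * N) lam t) with ⟨he, _⟩ | ⟨he, _⟩ <;> rw [he]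
      · simp; positivity
      · linarith
    calc _ ≤ Real.exp (ψ (t / 2)) * ((1 / 64) ^ k *
          (Real.exp (-ψ t) * max 1 (derivSum ψ (2 * N) lam t) ^ (2 * k))) := by
          refine mul_le_mul_of_nonneg_left ?_ (Real.exp_pos _).le
          exact (le_abs_self _).trans (h.abs_coeff_mul_iteratedDeriv_le hs hlam hsl hk2 t)
      _ ≤ Real.exp (ψ (t / 2)) * ((1 / 64) ^ k *
          (Real.exp (-ψ t) * (1 + derivSum ψ (2 * N) lam t ^ (2 * k)))) := by gcongr
      _ = (1 / 64) ^ k * (Real.exp (-ψ t + ψ (t / 2)) *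
          (1 + derivSum ψ (2 * N) lam t ^ (2 * k))) := by rw [hexp]; ring
      _ ≤ _ := by
          gcongr
          exact hb _ (by omega) (by omega)
  rw [backwardHeat_eq_add, mul_add, Finset.mul_sum]
  have h2 := Finset.sum_le_sum hterm
  rw [← Finset.sum_mul] at h2
  have h3 := mul_le_mul_of_nonneg_right (sum_Icc_pow_le_half N) hM0
  linarith

end RegularNegLogDensity

/-! ### Taylor expansion in `L¹` -/

/-- Remainder of the Taylor expansion of order `m` of `F (y - h)` in `h`. -/
noncomputable def taylorRem (F : ℝ → ℝ) (m : ℕ) (y h : ℝ) : ℝ :=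
  F (y - h) - ∑ i ∈ Finset.range m, (-h) ^ i / (i ! : ℝ) * iteratedDeriv i F y

theorem continuous_taylorRem {F : ℝ → ℝ} (hF : ContDiff ℝ (⊤ : ℕ∞) F) (m : ℕ) :
    Continuous fun p : ℝ × ℝ => taylorRem F m p.1 p.2 := by
  unfold taylorRem
  have h0 := hF.continuous
  have h1 : ∀ i, Continuous (iteratedDeriv i F) := fun i =>
    hF.continuous_iteratedDeriv i (by exact_mod_cast le_top)
  refine (h0.comp (by fun_prop)).sub (continuous_finsetSum _ fun i _ => ?_)
  have := h1 i
  fun_prop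

theorem hasDerivAt_taylorRem {F : ℝ → ℝ} (hF : ContDiff ℝ (⊤ : ℕ∞) F) (m : ℕ) (y h t : ℝ) :
    HasDerivAt (fun t => taylorRem F (m + 1) y (t * h)) (-h * taylorRem (deriv F) m y (t * h)) t := by
  have hd : Differentiable ℝ F := (contDiff_infty_iff_deriv.1 hF).1
  have hlin : HasDerivAt (fun t : ℝ => t * h) h t := by simpa using (hasDerivAt_id t).mul_const h
  have h1 : HasDerivAt (fun t => F (y - t * h)) (deriv F (y - t * h) * (-h)) t :=
    (hd _).hasDerivAt.comp t (hlin.const_sub y)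
  have h2 : ∀ i ∈ Finset.range m, HasDerivAt
      (fun t => (-(t * h)) ^ (i + 1) / ((i + 1)! : ℝ) * iteratedDeriv (i + 1) F y)
      (-h * ((-(t * h)) ^ i / (i ! : ℝ) * iteratedDeriv i (deriv F) y)) t := by
    intro i _
    have := (((hlin.neg).pow (i + 1)).div_const ((i + 1)! : ℝ)).mul_const
      (iteratedDeriv (i + 1) F y)
    convert! this using 1
    rw [iteratedDeriv_succ', Nat.factorial_succ]
    simp only [Pi.neg_apply, Nat.add_sub_cancel]
    push_cast
    field_simp
  have h3 := h1.sub (HasDerivAt.fun_sum h2)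
  have h4 := h3.sub_const (F y)
  convert! h4 using 1
  · ext t
    simp only [taylorRem, Finset.sum_range_succ', Pi.sub_apply]
    simp; ring
  · rw [taylorRem, ← Finset.mul_sum]; ring

theorem taylorRem_zero (F : ℝ → ℝ) (m : ℕ) (y : ℝ) : taylorRem F (m + 1) y 0 = 0 := by
  simp [taylorRem, Finset.sum_range_succ']

/-- Taylor's theorem in `L¹`. -/
theorem lintegral_abs_taylorRem_le {F : ℝ → ℝ} (hF : ContDiff ℝ (⊤ : ℕ∞) F) (m : ℕ) (h : ℝ) :
    ∫⁻ y, ENNReal.ofReal |taylorRem F m y h| ≤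
      ENNReal.ofReal (|h| ^ m / (m ! : ℝ)) * ∫⁻ y, ENNReal.ofReal |iteratedDeriv m F y| := by
  induction m generalizing F h with
  | zero =>
    simp only [taylorRem, Finset.range_zero, Finset.sum_empty, sub_zero]
    rw [lintegral_sub_right_eq_self (fun y => ENNReal.ofReal |F y|) h]
    simp
  | succ m ih =>
    have hF' : ContDiff ℝ (⊤ : ℕ∞) (deriv F) := (contDiff_infty_iff_deriv.1 hF).2
    have hcont := continuous_taylorRem hF' m
    have hmeas : Measurable fun p : ℝ × ℝ =>
        ENNReal.ofReal (|h| * |taylorRem (deriv F) m p.1 (p.2 * h)|) := by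
      have : Continuous fun p : ℝ × ℝ => taylorRem (deriv F) m p.1 (p.2 * h) :=
        hcont.comp (f := fun p : ℝ × ℝ => (p.1, p.2 * h)) (by fun_prop)
      exact ((this.abs.const_mul _).measurable).ennreal_ofReal
    have hpt : ∀ y, ENNReal.ofReal |taylorRem F (m + 1) y h| ≤
        ∫⁻ t in Set.Ioc (0 : ℝ) 1, ENNReal.ofReal (|h| * |taylorRem (deriv F) m y (t * h)|) := by
      intro y
      have hc : Continuous fun t : ℝ => -h * taylorRem (deriv F) m y (t * h) :=
        (hcont.comp (f := fun t : ℝ => (y, t * h)) (by fun_prop)).const_mul _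
      have h1 := intervalIntegral.integral_eq_sub_of_hasDerivAt
        (fun t _ => hasDerivAt_taylorRem hF m y h t) (hc.intervalIntegrable 0 1)
      rw [one_mul, zero_mul, taylorRem_zero, sub_zero, intervalIntegral.integral_of_le zero_le_one]
        at h1
      rw [← h1, ← Real.enorm_eq_ofReal_abs]
      refine (enorm_integral_le_lintegral_enorm _).trans (le_of_eq ?_)
      refine lintegral_congr fun t => ?_
      rw [Real.enorm_eq_ofReal_abs, abs_mul, abs_neg]
    calc ∫⁻ y, ENNReal.ofReal |taylorRem F (m + 1) y h|
        ≤ ∫⁻ y, ∫⁻ t in Set.Ioc (0 : ℝ) 1,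
            ENNReal.ofReal (|h| * |taylorRem (deriv F) m y (t * h)|) := lintegral_mono hpt
      _ = ∫⁻ t in Set.Ioc (0 : ℝ) 1, ∫⁻ y,
            ENNReal.ofReal (|h| * |taylorRem (deriv F) m y (t * h)|) :=
          lintegral_lintegral_swap hmeas.aemeasurable
      _ ≤ ∫⁻ t in Set.Ioc (0 : ℝ) 1, ENNReal.ofReal (|h| ^ (m + 1) / (m ! : ℝ) * t ^ m) *
            ∫⁻ y, ENNReal.ofReal |iteratedDeriv m (deriv F) y| := by
          refine setLIntegral_mono' measurableSet_Ioc fun t ht => ?_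
          simp_rw [ENNReal.ofReal_mul (abs_nonneg h)]
          rw [lintegral_const_mul' _ _ ENNReal.ofReal_ne_top]
          refine (mul_le_mul_right (ih hF' (t * h)) _).trans (le_of_eq ?_)
          rw [← mul_assoc, ← ENNReal.ofReal_mul (abs_nonneg h), abs_mul, abs_of_pos ht.1]
          congr 2; ring
      _ = _ := by
          rw [lintegral_mul_const _ (by fun_prop), iteratedDeriv_succ',
            ← ofReal_integral_eq_lintegral_ofReal]
          · congr 2
            rw [integral_const_mul, ← intervalIntegral.integral_of_le zero_le_one, integral_pow,
              Nat.factorial_succ]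
            push_cast
            field_simp
            simp
          · exact (Continuous.integrableOn_Icc (by fun_prop)).mono_set Set.Ioc_subset_Icc_self
          · refine (ae_restrict_iff' measurableSet_Ioc).2 (.of_forall fun t ht => ?_)
            have := ht.1.le
            simp only [Pi.zero_apply]; positivity

/-! ### Gaussian moments -/

theorem integrable_pow_gaussianReal (v : ℝ≥0) (n : ℕ) :
    Integrable (fun x : ℝ => x ^ n) (gaussianReal 0 v) := by
  have := (memLp_id_gaussianReal (μ := 0) (v := v) n).integrable_norm_pow'
  refine (integrable_norm_iff (by fun_prop)).1 ?_
  simpa using this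

/-- Integration by parts against the Gaussian density. -/
theorem integral_pow_add_two_gaussianReal {v : ℝ≥0} (hv : v ≠ 0) (n : ℕ) :
    ∫ x, x ^ (n + 2) ∂gaussianReal 0 v = v * (n + 1) * ∫ x, x ^ n ∂gaussianReal 0 v := by
  have hv' : (v : ℝ) ≠ 0 := by exact_mod_cast hv
  have hint : ∀ n : ℕ, Integrable fun x : ℝ => gaussianPDFReal 0 v x * x ^ n := by
    intro n
    have := integrable_pow_gaussianReal v n
    rw [gaussianReal_of_var_ne_zero _ hv, gaussianPDF_def,
      integrable_withDensity_iff_integrable_smul' (by fun_prop) (by simp)] at this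
    simpa [ENNReal.toReal_ofReal (gaussianPDFReal_nonneg _ _ _)] using this
  have hd : ∀ x, HasDerivAt (fun x : ℝ => gaussianPDFReal 0 v x * x ^ (n + 1))
      ((n + 1) * (gaussianPDFReal 0 v x * x ^ n) -
        (v : ℝ)⁻¹ * (gaussianPDFReal 0 v x * x ^ (n + 2))) x := by
    intro x
    have h1 : HasDerivAt (gaussianPDFReal 0 v) (gaussianPDFReal 0 v x * (-x / v)) x := by
      have h2 : HasDerivAt (fun x : ℝ => -(x - 0) ^ 2 / (2 * v)) (-x / v) x := by
        have := ((((hasDerivAt_id x).sub_const 0).pow 2).neg).div_const (2 * (v : ℝ))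
        convert! this using 1
        simp; field_simp
      have h3 := h2.exp.const_mul (√(2 * Real.pi * v))⁻¹
      convert! h3 using 1
      simp only [gaussianPDFReal]; ring
    have h4 := h1.mul (hasDerivAt_pow (n + 1) x)
    convert! h4 using 1
    simp only [Nat.add_sub_cancel]
    push_cast
    field_simp
    ring
  have h0 := integral_eq_zero_of_hasDerivAt_of_integrable hd
    (((hint n).const_mul _).sub ((hint (n + 2)).const_mul _)) (hint (n + 1))
  rw [integral_sub ((hint n).const_mul _) ((hint (n + 2)).const_mul _), integral_const_mul,
    integral_const_mul] at h0
  simp only [integral_gaussianReal_eq_integral_smul hv, smul_eq_mul]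
  field_simp at h0
  linarith

theorem integral_pow_two_mul_div_factorial_gaussianReal {v : ℝ≥0} (hv : v ≠ 0) (j : ℕ) :
    ∫ x, x ^ (2 * j) / ((2 * j)! : ℝ) ∂gaussianReal 0 v = v ^ j / ((2 * j)‼ : ℝ) := by
  rw [integral_div]
  induction j with
  | zero => simp
  | succ j ih =>
    rw [show 2 * (j + 1) = 2 * j + 2 by ring, integral_pow_add_two_gaussianReal hv,
      Nat.doubleFactorial_add_two, Nat.factorial_succ, Nat.factorial_succ, pow_succ]
    rw [div_eq_div_iff (by positivity) 
      (Nat.cast_ne_zero.2 (by have := Nat.doubleFactorial_pos (2 * j); positivity))] at ih ⊢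
    push_cast
    linear_combination (v : ℝ) * (2 * j + 1) * (2 * j + 2) * ih

theorem integral_pow_odd_gaussianReal {v : ℝ≥0} (hv : v ≠ 0) (j : ℕ) :
    ∫ x, x ^ (2 * j + 1) ∂gaussianReal 0 v = 0 := by
  induction j with
  | zero => simp
  | succ j ih =>
    rw [show 2 * (j + 1) + 1 = (2 * j + 1) + 2 by ring, integral_pow_add_two_gaussianReal hv, ih,
      mul_zero]

/-! ### Gaussian smoothing of the backward heat operator -/

/-- Taylor polynomial in `h` of `backwardHeat s N F (y - h)`, where the term `F^{(2k)}` is expanded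
up to the order `2 (N - k)`: derivatives beyond order `2 N` never enter. -/
noncomputable def heatTaylor (s : ℝ) (N : ℕ) (F : ℝ → ℝ) (y h : ℝ) : ℝ :=
  ∑ k ∈ Finset.range (N + 1), (-1) ^ k * s ^ (2 * k) / ((2 * k)‼ : ℝ) *
    ∑ i ∈ Finset.range (2 * (N - k)), (-h) ^ i / (i ! : ℝ) * iteratedDeriv (2 * k + i) F y

theorem iteratedDeriv_iteratedDeriv (F : ℝ → ℝ) (i k : ℕ) :
    iteratedDeriv i (iteratedDeriv k F) = iteratedDeriv (k + i) F := by
  induction i with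
  | zero => simp
  | succ i ih => rw [iteratedDeriv_succ, ih, ← add_assoc, iteratedDeriv_succ]

theorem contDiff_iteratedDeriv {F : ℝ → ℝ} (hF : ContDiff ℝ (⊤ : ℕ∞) F) (k : ℕ) :
    ContDiff ℝ (⊤ : ℕ∞) (iteratedDeriv k F) := by
  induction k with
  | zero => simpa using hF
  | succ k ih => rw [iteratedDeriv_succ]; exact (contDiff_infty_iff_deriv.1 ih).2

theorem backwardHeat_sub_heatTaylor (s : ℝ) (N : ℕ) (F : ℝ → ℝ) (y h : ℝ) :
    backwardHeat s N F (y - h) - heatTaylor s N F y h =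
      ∑ k ∈ Finset.range (N + 1), (-1) ^ k * s ^ (2 * k) / ((2 * k)‼ : ℝ) *
        taylorRem (iteratedDeriv (2 * k) F) (2 * (N - k)) y h := by
  rw [backwardHeat, heatTaylor, ← Finset.sum_sub_distrib]
  refine Finset.sum_congr rfl fun k _ => ?_
  simp only [taylorRem, iteratedDeriv_iteratedDeriv]
  ring

theorem continuous_backwardHeat_of_contDiff {F : ℝ → ℝ} (hF : ContDiff ℝ (⊤ : ℕ∞) F) (s : ℝ) (N : ℕ) :
    Continuous (backwardHeat s N F) := by
  unfold backwardHeat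
  exact continuous_finsetSum _ fun k _ => (contDiff_iteratedDeriv hF _).continuous.const_mul _

theorem continuous_heatTaylor {F : ℝ → ℝ} (hF : ContDiff ℝ (⊤ : ℕ∞) F) (s : ℝ) (N : ℕ) :
    Continuous fun p : ℝ × ℝ => heatTaylor s N F p.1 p.2 := by
  unfold heatTaylor
  have h1 : ∀ i, Continuous (iteratedDeriv i F) := fun i => (contDiff_iteratedDeriv hF i).continuous
  refine continuous_finsetSum _ fun k _ => (continuous_finsetSum _ fun i _ => ?_).const_mul _
  have := h1 (2 * k + i)
  fun_prop

theorem integrable_taylorTerm (v : ℝ≥0) (i : ℕ) (c : ℝ) :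
    Integrable (fun h : ℝ => (-h) ^ i / (i ! : ℝ) * c) (gaussianReal 0 v) := by
  have := (((integrable_pow_gaussianReal v i).const_mul ((-1) ^ i)).div_const (i ! : ℝ)).mul_const c
  simpa only [← neg_pow] using this

theorem integrable_heatTaylor (s : ℝ) (N : ℕ) (F : ℝ → ℝ) (y : ℝ) (v : ℝ≥0) :
    Integrable (heatTaylor s N F y) (gaussianReal 0 v) := by
  unfold heatTaylor
  refine integrable_finsetSum _ fun k _ => (integrable_finsetSum _ fun i _ => ?_).const_mul _
  exact integrable_taylorTerm v i _

theorem sum_range_two_mul (a : ℕ → ℝ) (n : ℕ) :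
    ∑ i ∈ Finset.range (2 * n), a i = ∑ j ∈ Finset.range n, (a (2 * j) + a (2 * j + 1)) := by
  induction n with
  | zero => simp
  | succ n ih =>
    rw [show 2 * (n + 1) = 2 * n + 1 + 1 by ring, Finset.sum_range_succ, Finset.sum_range_succ, ih,
      Finset.sum_range_succ]
    ring

theorem sum_neg_one_pow_div_doubleFactorial (m : ℕ) :
    ∑ k ∈ Finset.range (m + 1), (-1 : ℝ) ^ k / (((2 * k)‼ : ℝ) * ((2 * (m - k))‼ : ℝ)) =
      if m = 0 then 1 else 0 := by
  have h : ∀ k ∈ Finset.range (m + 1),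
      (-1 : ℝ) ^ k / (((2 * k)‼ : ℝ) * ((2 * (m - k))‼ : ℝ)) =
        (-1) ^ k * 1 ^ (m - k) * (m.choose k) / (2 ^ m * (m ! : ℝ)) := by
    intro k hk
    have hkm : k ≤ m := Nat.lt_succ_iff.1 (Finset.mem_range.1 hk)
    have h1 : (2 : ℝ) ^ m = 2 ^ k * 2 ^ (m - k) := by rw [← pow_add]; congr 1; omega
    have h2 : (m ! : ℝ) = m.choose k * k ! * (m - k)! := by
      exact_mod_cast (Nat.choose_mul_factorial_mul_factorial hkm).symm
    have h3 : (m.choose k : ℝ) ≠ 0 := by exact_mod_cast (Nat.choose_pos hkm).ne'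
    rw [Nat.doubleFactorial_two_mul, Nat.doubleFactorial_two_mul, h1, h2]
    push_cast
    field_simp
    simp
  rw [Finset.sum_congr rfl h, ← Finset.sum_div, ← add_pow]
  rcases eq_or_ne m 0 with rfl | hm <;> simp [*]

/-- Gaussian smoothing inverts the truncated backward heat operator on Taylor polynomials. -/
theorem integral_heatTaylor {v : ℝ≥0} (hv : v ≠ 0) {s : ℝ} (hs : s ^ 2 = v) {N : ℕ} (hN : 1 ≤ N)
    (F : ℝ → ℝ) (y : ℝ) : ∫ h, heatTaylor s N F y h ∂gaussianReal 0 v = F y := by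
  have hint : ∀ k i : ℕ, Integrable
      (fun h : ℝ => (-h) ^ i / (i ! : ℝ) * iteratedDeriv (2 * k + i) F y) (gaussianReal 0 v) :=
    fun k i => integrable_taylorTerm v i _
  have hinner : ∀ k : ℕ, ∫ h, ∑ i ∈ Finset.range (2 * (N - k)),
      (-h) ^ i / (i ! : ℝ) * iteratedDeriv (2 * k + i) F y ∂gaussianReal 0 v =
        ∑ j ∈ Finset.range (N - k),
          s ^ (2 * j) / ((2 * j)‼ : ℝ) * iteratedDeriv (2 * (k + j)) F y := by
    intro k
    rw [integral_finsetSum _ fun i _ => hint k i, sum_range_two_mul]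
    refine Finset.sum_congr rfl fun j _ => ?_
    rw [integral_mul_const, integral_mul_const]
    have h1 : ∫ h : ℝ, (-h) ^ (2 * j) / ((2 * j)! : ℝ) ∂gaussianReal 0 v =
        s ^ (2 * j) / ((2 * j)‼ : ℝ) := by
      simp_rw [(even_two_mul j).neg_pow]
      rw [integral_pow_two_mul_div_factorial_gaussianReal hv, ← hs, pow_mul]
    have h2 : ∫ h : ℝ, (-h) ^ (2 * j + 1) / ((2 * j + 1)! : ℝ) ∂gaussianReal 0 v = 0 := by
      simp_rw [(odd_two_mul_add_one j).neg_pow]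
      rw [integral_div, integral_neg, integral_pow_odd_gaussianReal hv]
      simp
    rw [h1, h2, zero_mul, add_zero, mul_add]
  unfold heatTaylor
  rw [integral_finsetSum _ fun k _ => (integrable_finsetSum _ fun i _ => hint k i).const_mul _]
  simp_rw [integral_const_mul, hinner]
  rw [Finset.sum_range_succ, Nat.sub_self, Finset.range_zero, Finset.sum_empty, mul_zero, add_zero]
  simp_rw [Finset.mul_sum]
  rw [← Finset.sum_range_diag_flip N fun k j => (-1) ^ k * s ^ (2 * k) / ((2 * k)‼ : ℝ) *
    (s ^ (2 * j) / ((2 * j)‼ : ℝ) * iteratedDeriv (2 * (k + j)) F y)]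
  have h3 : ∀ m ∈ Finset.range N, ∑ k ∈ Finset.range (m + 1),
      (-1) ^ k * s ^ (2 * k) / ((2 * k)‼ : ℝ) *
        (s ^ (2 * (m - k)) / ((2 * (m - k))‼ : ℝ) * iteratedDeriv (2 * (k + (m - k))) F y) =
      (if m = 0 then 1 else 0) * (s ^ (2 * m) * iteratedDeriv (2 * m) F y) := by
    intro m _
    rw [← sum_neg_one_pow_div_doubleFactorial, Finset.sum_mul]
    refine Finset.sum_congr rfl fun k hk => ?_
    have hkm : k ≤ m := Nat.lt_succ_iff.1 (Finset.mem_range.1 hk)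
    rw [Nat.add_sub_cancel' hkm, show s ^ (2 * m) = s ^ (2 * k) * s ^ (2 * (m - k)) by
      rw [← pow_add]; congr 1; omega]
    ring
  rw [Finset.sum_congr rfl h3, Finset.sum_eq_single 0 (by intro m _ hm; simp [hm])
    (by intro h; exact absurd (Finset.mem_range.2 hN) h)]
  simp

/-- Truncation error of the backward heat operator after Gaussian smoothing. -/
theorem lintegral_backwardHeat_sub_heatTaylor_le {v : ℝ≥0} (hv : v ≠ 0) {s : ℝ} (hs0 : 0 ≤ s)
    (hs : s ^ 2 = v) (N : ℕ) {F : ℝ → ℝ} (hF : ContDiff ℝ (⊤ : ℕ∞) F) :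
    ∫⁻ h, ∫⁻ y, ENNReal.ofReal |backwardHeat s N F (y - h) - heatTaylor s N F y h| ∂volume
        ∂gaussianReal 0 v ≤
      ENNReal.ofReal ((N + 1) * s ^ (2 * N)) *
        ∫⁻ y, ENNReal.ofReal |iteratedDeriv (2 * N) F y| := by
  set I := ∫⁻ y, ENNReal.ofReal |iteratedDeriv (2 * N) F y| with hI
  have hc : ∀ k : ℕ, 0 ≤ s ^ (2 * k) / ((2 * k)‼ : ℝ) := fun k => by positivity
  have hpt : ∀ h, ∫⁻ y, ENNReal.ofReal |backwardHeat s N F (y - h) - heatTaylor s N F y h| ≤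
      ∑ k ∈ Finset.range (N + 1), ENNReal.ofReal (s ^ (2 * k) / ((2 * k)‼ : ℝ)) *
        (ENNReal.ofReal (h ^ (2 * (N - k)) / ((2 * (N - k))! : ℝ)) * I) := by
    intro h
    calc _ ≤ ∫⁻ y, ∑ k ∈ Finset.range (N + 1), ENNReal.ofReal (s ^ (2 * k) / ((2 * k)‼ : ℝ)) *
          ENNReal.ofReal |taylorRem (iteratedDeriv (2 * k) F) (2 * (N - k)) y h| := by
          refine lintegral_mono fun y => ?_
          simp_rw [← ENNReal.ofReal_mul (hc _)]
          rw [← ENNReal.ofReal_sum_of_nonneg fun k _ => mul_nonneg (hc k) (abs_nonneg _)]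
          refine ENNReal.ofReal_le_ofReal ?_
          rw [backwardHeat_sub_heatTaylor]
          refine (Finset.abs_sum_le_sum_abs _ _).trans (le_of_eq ?_)
          simp_rw [abs_coeff]
      _ = ∑ k ∈ Finset.range (N + 1), ENNReal.ofReal (s ^ (2 * k) / ((2 * k)‼ : ℝ)) *
          ∫⁻ y, ENNReal.ofReal |taylorRem (iteratedDeriv (2 * k) F) (2 * (N - k)) y h| := by
          rw [lintegral_finsetSum' _ fun k _ => ?_]
          · simp_rw [lintegral_const_mul' _ _ ENNReal.ofReal_ne_top]
          · exact ((((continuous_taylorRem (contDiff_iteratedDeriv hF (2 * k))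
              (2 * (N - k))).comp (Continuous.prodMk_left h)).abs.measurable.ennreal_ofReal).const_mul
              _).aemeasurable
      _ ≤ _ := by
          refine Finset.sum_le_sum fun k hk => mul_le_mul_right ?_ _
          have hkN : k ≤ N := Nat.lt_succ_iff.1 (Finset.mem_range.1 hk)
          have := lintegral_abs_taylorRem_le (contDiff_iteratedDeriv hF (2 * k)) (2 * (N - k)) h
          rwa [iteratedDeriv_iteratedDeriv, show 2 * k + 2 * (N - k) = 2 * N by omega,
            (even_two_mul _).pow_abs] at this
  refine (lintegral_mono hpt).trans ?_
  have hmom : ∀ j : ℕ, ∫⁻ h, ENNReal.ofReal (h ^ (2 * j) / ((2 * j)! : ℝ)) ∂gaussianReal 0 v =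
      ENNReal.ofReal (s ^ (2 * j) / ((2 * j)‼ : ℝ)) := by
    intro j
    rw [← ofReal_integral_eq_lintegral_ofReal ((integrable_pow_gaussianReal v _).div_const _)
      (.of_forall fun h => div_nonneg ((even_two_mul j).pow_nonneg h) (by positivity)),
      integral_pow_two_mul_div_factorial_gaussianReal hv, ← hs, pow_mul]
  rw [lintegral_finsetSum _ fun k _ => by fun_prop]
  have hterm : ∀ k ∈ Finset.range (N + 1), ∫⁻ h, ENNReal.ofReal (s ^ (2 * k) / ((2 * k)‼ : ℝ)) *
        (ENNReal.ofReal (h ^ (2 * (N - k)) / ((2 * (N - k))! : ℝ)) * I) ∂gaussianReal 0 v ≤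
      ENNReal.ofReal (s ^ (2 * N)) * I := by
    intro k hk
    have hkN : k ≤ N := Nat.lt_succ_iff.1 (Finset.mem_range.1 hk)
    rw [lintegral_const_mul' _ _ ENNReal.ofReal_ne_top, lintegral_mul_const _ (by fun_prop), hmom,
      ← mul_assoc, ← ENNReal.ofReal_mul (hc k)]
    gcongr
    have h1 : ∀ j : ℕ, s ^ (2 * j) / ((2 * j)‼ : ℝ) ≤ s ^ (2 * j) := fun j =>
      div_le_self (by positivity) (by exact_mod_cast Nat.doubleFactorial_pos _)
    calc _ ≤ s ^ (2 * k) * s ^ (2 * (N - k)) :=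
          mul_le_mul (h1 _) (h1 _) (hc _) (by positivity)
      _ = _ := by rw [← pow_add]; congr 1; omega
  refine (Finset.sum_le_sum hterm).trans (le_of_eq ?_)
  rw [Finset.sum_const, Finset.card_range, nsmul_eq_mul, ENNReal.ofReal_mul (by positivity),
    mul_assoc]
  congr 1
  rw [show ((N : ℝ) + 1) = ((N + 1 : ℕ) : ℝ) by push_cast; rfl, ENNReal.ofReal_natCast]

/-! ### Total variation and affine substitutions -/

theorem tvDist_densMeasure_le {f g : ℝ → ℝ} (hf : Measurable f) (hg : Measurable g) :
    tvDist (densMeasure f) (densMeasure g) ≤ ∫⁻ y, ENNReal.ofReal |f y - g y| := by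
  have key : ∀ (f g : ℝ → ℝ), Measurable g → ∀ A, MeasurableSet A →
      densMeasure f A - densMeasure g A ≤ ∫⁻ y, ENNReal.ofReal |f y - g y| := by
    intro f g hg A hA
    rw [tsub_le_iff_right, densMeasure, densMeasure, withDensity_apply _ hA, withDensity_apply _ hA]
    calc ∫⁻ y in A, ENNReal.ofReal (f y)
        ≤ ∫⁻ y in A, (ENNReal.ofReal |f y - g y| + ENNReal.ofReal (g y)) := by
          refine lintegral_mono fun y => ?_
          refine (ENNReal.ofReal_le_ofReal ?_).trans ENNReal.ofReal_add_le
          linarith [le_abs_self (f y - g y)]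
      _ = (∫⁻ y in A, ENNReal.ofReal |f y - g y|) + ∫⁻ y in A, ENNReal.ofReal (g y) :=
          lintegral_add_right _ hg.ennreal_ofReal
      _ ≤ _ := add_le_add_left (setLIntegral_le_lintegral _ _) _
  refine iSup₂_le fun A hA => max_le (key f g hg A hA) ?_
  have := key g f hf A hA
  simpa only [abs_sub_comm] using this

theorem lintegral_affine {τ : ℝ} (hτ : 0 < τ) (x : ℝ) {H : ℝ → ℝ≥0∞} (hH : Measurable H) :
    ∫⁻ y, H y = ENNReal.ofReal τ * ∫⁻ t, H (τ * t + x) := by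
  calc ∫⁻ y, H y = ∫⁻ y, H (y + x) := (lintegral_add_right_eq_self H x).symm
    _ = ∫⁻ y, H (y + x) ∂(ENNReal.ofReal |τ| • Measure.map (τ * ·) volume) := by
        rw [Real.smul_map_volume_mul_left hτ.ne']
    _ = _ := by
        rw [lintegral_smul_measure, lintegral_map (by fun_prop) (by fun_prop), abs_of_pos hτ,
          smul_eq_mul]

theorem lintegral_scaled_density {τ : ℝ} (hτ : 0 < τ) (x : ℝ) {k : ℝ → ℝ} (hk : Measurable k) :
    ∫⁻ y, ENNReal.ofReal (1 / τ * k ((y - x) / τ)) = ∫⁻ t, ENNReal.ofReal (k t) := by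
  rw [lintegral_affine hτ x (by fun_prop), ← lintegral_const_mul' _ _ ENNReal.ofReal_ne_top]
  refine lintegral_congr fun t => ?_
  rw [← ENNReal.ofReal_mul hτ.le]
  congr 1
  rw [show (τ * t + x - x) / τ = t by field_simp; ring]
  field_simp

theorem integral_scaled_density {τ : ℝ} (hτ : 0 < τ) (x : ℝ) (k : ℝ → ℝ) :
    ∫ y, 1 / τ * k ((y - x) / τ) = ∫ t, k t := by
  rw [integral_sub_right_eq_self (fun y => 1 / τ * k (y / τ)) x, integral_const_mul,
    Measure.integral_comp_div, abs_of_pos hτ, smul_eq_mul]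
  field_simp

theorem sourceDensity_eq_gaussianPDFReal {σ : ℝ} (hσ : 0 < σ) (x θ : ℝ) :
    sourceDensity σ x θ = gaussianPDFReal θ (σ ^ 2).toNNReal x := by
  have h : ((σ ^ 2).toNNReal : ℝ) = σ ^ 2 := Real.coe_toNNReal _ (by positivity)
  rw [sourceDensity, gaussianPDFReal, h, Real.sqrt_mul (x := 2 * Real.pi) (by positivity),
    Real.sqrt_sq hσ.le, one_div]

theorem toNNReal_sq_ne_zero {σ : ℝ} (hσ : 0 < σ) : (σ ^ 2).toNNReal ≠ 0 := by
  rw [ne_eq, Real.toNNReal_eq_zero, not_le]; positivity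

theorem integral_mul_sourceDensity {σ : ℝ} (hσ : 0 < σ) (θ : ℝ) (k : ℝ → ℝ) :
    ∫ x, k x * sourceDensity σ x θ = ∫ x, k x ∂gaussianReal θ (σ ^ 2).toNNReal := by
  rw [integral_gaussianReal_eq_integral_smul (toNNReal_sq_ne_zero hσ)]
  refine integral_congr_ae (.of_forall fun x => ?_)
  simp only [sourceDensity_eq_gaussianPDFReal hσ, smul_eq_mul, mul_comm]

/-! ### The normalized positive part -/

/-- Normalized positive part of the signed kernel at unit scale. -/
noncomputable def unitKernel (ψ : ℝ → ℝ) (s : ℝ) (N : ℕ) (t : ℝ) : ℝ :=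
  max (backwardHeat s N (fun t => Real.exp (-ψ t)) t) 0 /
    ∫ t, max (backwardHeat s N (fun t => Real.exp (-ψ t)) t) 0

namespace RegularNegLogDensity

variable {ψ : ℝ → ℝ} {C : ℕ} {Ct : ℝ} {s lam τ σ : ℝ} {N : ℕ}

theorem integrable_posPart_backwardHeat (h : RegularNegLogDensity ψ C Ct) (s : ℝ) (N : ℕ) :
    Integrable fun t => max (backwardHeat s N (fun t => Real.exp (-ψ t)) t) 0 :=
  (h.integrable_backwardHeat s N).pos_part

theorem one_le_integral_posPart_backwardHeat (h : RegularNegLogDensity ψ C Ct) (s : ℝ) (N : ℕ) :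
    1 ≤ ∫ t, max (backwardHeat s N (fun t => Real.exp (-ψ t)) t) 0 := by
  rw [← h.integral_backwardHeat s N]
  exact integral_mono (h.integrable_backwardHeat s N) (h.integrable_posPart_backwardHeat s N)
    fun t => le_max_left _ _

theorem measurable_unitKernel (h : RegularNegLogDensity ψ C Ct) (s : ℝ) (N : ℕ) :
    Measurable (unitKernel ψ s N) :=
  ((h.continuous_backwardHeat s N).measurable.max measurable_const).div_const _

theorem unitKernel_nonneg (h : RegularNegLogDensity ψ C Ct) (s : ℝ) (N : ℕ) (t : ℝ) :
    0 ≤ unitKernel ψ s N t :=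
  div_nonneg (le_max_right _ _)
    (zero_le_one.trans (h.one_le_integral_posPart_backwardHeat s N))

theorem lintegral_unitKernel (h : RegularNegLogDensity ψ C Ct) (s : ℝ) (N : ℕ) :
    ∫⁻ t, ENNReal.ofReal (unitKernel ψ s N t) = 1 := by
  have hp := h.one_le_integral_posPart_backwardHeat s N
  have hi : Integrable (unitKernel ψ s N) := (h.integrable_posPart_backwardHeat s N).div_const _
  rw [← ofReal_integral_eq_lintegral_ofReal hi (.of_forall (h.unitKernel_nonneg s N))]
  simp only [unitKernel]
  rw [integral_div, div_self (by linarith), ENNReal.ofReal_one]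

/-- The cost in `L¹` of the positive part and the normalization: each costs the mass of the
negative part. -/
theorem lintegral_abs_unitKernel_sub_le (h : RegularNegLogDensity ψ C Ct) (hs : 0 ≤ s)
    (hlam : 0 < lam) (hsl : s * lam * (2 * N) ≤ 1 / 8) :
    ∫⁻ t, ENNReal.ofReal |unitKernel ψ s N t - backwardHeat s N (fun t => Real.exp (-ψ t)) t| ≤
      errTerm ψ (2 * N) lam := by
  set g := backwardHeat s N (fun t => Real.exp (-ψ t)) with hg
  set p := ∫ t, max (g t) 0 with hpdef
  have hp : 1 ≤ p := h.one_le_integral_posPart_backwardHeat s N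
  have hgi : Integrable g := h.integrable_backwardHeat s N
  have hgp : Integrable fun t => max (g t) 0 := h.integrable_posPart_backwardHeat s N
  have hgm : Measurable g := (h.continuous_backwardHeat s N).measurable
  have hneg : ENNReal.ofReal (p - 1) = ∫⁻ t, ENNReal.ofReal (-g t) := by
    have h1 : p - 1 = ∫ t, max (-g t) 0 := by
      rw [← h.integral_backwardHeat s N, hpdef, ← integral_sub hgp hgi]
      refine integral_congr_ae (.of_forall fun t => ?_)
      simp only
      rcases le_total 0 (g t) with h0 | h0
      · rw [max_eq_left h0, max_eq_right (by linarith)]; ring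
      · rw [max_eq_right h0, max_eq_left (by linarith)]; ring
    rw [h1, ofReal_integral_eq_lintegral_ofReal hgi.neg_part (.of_forall fun t => le_max_right _ _)]
    simp
  have hnorm : ∫⁻ t, ENNReal.ofReal ((1 - 1 / p) * max (g t) 0) = ENNReal.ofReal (p - 1) := by
    have h1 : 0 ≤ 1 - 1 / p := by
      rw [sub_nonneg, div_le_one (by linarith)]; exact hp
    rw [← ofReal_integral_eq_lintegral_ofReal (hgp.const_mul _)
      (.of_forall fun t => mul_nonneg h1 (le_max_right _ _)), integral_const_mul, ← hpdef]
    congr 1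
    have : p ≠ 0 := by linarith
    field_simp
  calc ∫⁻ t, ENNReal.ofReal |unitKernel ψ s N t - g t|
      ≤ ∫⁻ t, (ENNReal.ofReal ((1 - 1 / p) * max (g t) 0) + ENNReal.ofReal (-g t)) := by
        refine lintegral_mono fun t => ?_
        rw [show ENNReal.ofReal (-g t) = ENNReal.ofReal (max (-g t) 0) by simp]
        have h1 : 0 ≤ 1 - 1 / p := by
          rw [sub_nonneg, div_le_one (by linarith)]; exact hp
        rw [← ENNReal.ofReal_add (mul_nonneg h1 (le_max_right _ _)) (le_max_right _ _)]
        refine ENNReal.ofReal_le_ofReal ?_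
        have h2 : unitKernel ψ s N t - g t = -((1 - 1 / p) * max (g t) 0) + max (-g t) 0 := by
          have : unitKernel ψ s N t = 1 / p * max (g t) 0 := by
            rw [unitKernel, div_eq_inv_mul, one_div]
          rw [this]
          rcases le_total 0 (g t) with h0 | h0
          · rw [max_eq_left h0, max_eq_right (by linarith)]; ring
          · rw [max_eq_right h0, max_eq_left (by linarith)]; ring
        rw [h2]
        refine (abs_add_le _ _).trans ?_
        rw [abs_neg, abs_of_nonneg (mul_nonneg h1 (le_max_right _ _)),
          abs_of_nonneg (le_max_right _ _)]
    _ = 2 * ∫⁻ t, ENNReal.ofReal (-g t) := by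
        rw [lintegral_add_right _ (by fun_prop), hnorm, hneg, two_mul]
    _ ≤ 2 * (ENNReal.ofReal (1 / 2) * errTerm ψ (2 * N) lam) :=
        mul_le_mul_right (h.lintegral_neg_backwardHeat_le hs hlam hsl) _
    _ = errTerm ψ (2 * N) lam := by
        rw [← mul_assoc, ← ENNReal.ofReal_ofNat 2, ← ENNReal.ofReal_mul (by norm_num)]
        norm_num

theorem normalizedPosPart_eq (h : RegularNegLogDensity ψ C Ct) (hτ : 0 < τ) (σ : ℝ) (N : ℕ)
    (y x : ℝ) : normalizedPosPart (signedKernel (targetDensity ψ τ) σ N) y x =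
      1 / τ * unitKernel ψ (σ / τ) N ((y - x) / τ) := by
  have h1 : ∀ y, max (signedKernel (targetDensity ψ τ) σ N y x) 0 =
      1 / τ * max (backwardHeat (σ / τ) N (fun t => Real.exp (-ψ t)) ((y - x) / τ)) 0 := by
    intro y
    rw [signedKernel_targetDensity h.smooth, mul_max_of_nonneg _ _ (by positivity), mul_zero]
  rw [normalizedPosPart]
  simp_rw [h1]
  rw [integral_scaled_density hτ x
    (fun t => max (backwardHeat (σ / τ) N (fun t => Real.exp (-ψ t)) t) 0), unitKernel]
  ring

theorem isMarkovDensity_normalizedPosPart (h : RegularNegLogDensity ψ C Ct) (hτ : 0 < τ) (σ : ℝ)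
    (N : ℕ) : IsMarkovDensity (normalizedPosPart (signedKernel (targetDensity ψ τ) σ N)) := by
  have hm := h.measurable_unitKernel (σ / τ) N
  intro x
  simp only [h.normalizedPosPart_eq hτ]
  refine ⟨by fun_prop, fun y => mul_nonneg (by positivity) (h.unitKernel_nonneg _ _ _), ?_⟩
  rw [lintegral_scaled_density hτ x hm, h.lintegral_unitKernel]

theorem measurable_normalizedPosPart (h : RegularNegLogDensity ψ C Ct) (hτ : 0 < τ) (σ : ℝ)
    (N : ℕ) : Measurable fun p : ℝ × ℝ =>
      normalizedPosPart (signedKernel (targetDensity ψ τ) σ N) p.1 p.2 := by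
  have hm := h.measurable_unitKernel (σ / τ) N
  simp only [h.normalizedPosPart_eq hτ]
  fun_prop

theorem ae_integrable_normalizedPosPart (h : RegularNegLogDensity ψ C Ct) (hτ : 0 < τ) (σ : ℝ)
    (N : ℕ) (γ : Measure ℝ) [IsProbabilityMeasure γ] :
    ∀ᵐ y, Integrable (normalizedPosPart (signedKernel (targetDensity ψ τ) σ N) y) γ := by
  have hm := h.measurable_normalizedPosPart hτ σ N
  have hM := h.isMarkovDensity_normalizedPosPart hτ σ N
  have h1 : ∫⁻ y, ∫⁻ x, ENNReal.ofReal
      (normalizedPosPart (signedKernel (targetDensity ψ τ) σ N) y x) ∂γ = 1 := by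
    rw [lintegral_lintegral_swap hm.ennreal_ofReal.aemeasurable]
    simp [(hM _).2.2]
  have h2 := ae_lt_top (f := fun y => ∫⁻ x, ENNReal.ofReal
      (normalizedPosPart (signedKernel (targetDensity ψ τ) σ N) y x) ∂γ)
      (hm.ennreal_ofReal.lintegral_prod_right') (by rw [h1]; exact ENNReal.one_ne_top)
  filter_upwards [h2] with y hy
  refine ⟨(hm.comp measurable_prodMk_left).aestronglyMeasurable, ?_⟩
  rw [hasFiniteIntegral_iff_ofReal (.of_forall fun x => (hM x).2.1 y)]
  exact hy

/-- The mixture of the kernel over the source has the density that enters the deficiency. -/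
theorem lintegral_densMeasure_normalizedPosPart (h : RegularNegLogDensity ψ C Ct) (hτ : 0 < τ)
    (hσ : 0 < σ) (N : ℕ) (θ : ℝ) {A : Set ℝ} (hA : MeasurableSet A) :
    ∫⁻ x, densMeasure (fun y => normalizedPosPart (signedKernel (targetDensity ψ τ) σ N) y x) A
        ∂gaussianReal θ (σ ^ 2).toNNReal =
      densMeasure (fun y => ∫ x, normalizedPosPart (signedKernel (targetDensity ψ τ) σ N) y x *
        sourceDensity σ x θ) A := by
  have hm := h.measurable_normalizedPosPart hτ σ N
  have hM := h.isMarkovDensity_normalizedPosPart hτ σ N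
  simp only [integral_mul_sourceDensity hσ, densMeasure, withDensity_apply _ hA]
  rw [lintegral_lintegral_swap (f := fun x y => ENNReal.ofReal
    (normalizedPosPart (signedKernel (targetDensity ψ τ) σ N) y x))
    (hm.ennreal_ofReal.comp measurable_swap).aemeasurable]
  refine setLIntegral_congr_fun_ae hA ?_
  filter_upwards [h.ae_integrable_normalizedPosPart hτ σ N
    (gaussianReal θ (σ ^ 2).toNNReal)] with y hy _
  rw [ofReal_integral_eq_lintegral_ofReal hy (.of_forall fun x => (hM x).2.1 y)]

end RegularNegLogDensity

/-! ### The deficiency bound -/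

theorem Cbar_ge (C : ℕ) : 16 ≤ Cbar C := by
  have h1 : (1 : ℝ) ≤ Real.exp 1 := Real.one_le_exp zero_le_one
  have h2 : (1 : ℝ) ≤ (2 * Real.exp 1) ^ (4 * (1 + C)) := one_le_pow₀ (by linarith)
  have h3 : (1 : ℝ) ≤ Real.exp 1 ^ (4 * (1 + C) ^ 2) := one_le_pow₀ h1
  have h4 : (1 : ℝ) ≤ Real.pi ^ 2 := one_le_pow₀ (by linarith [Real.pi_gt_three])
  unfold Cbar
  calc (16 : ℝ) = 16 * 1 * 1 * 1 := by norm_num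
    _ ≤ _ := by gcongr

/-- The truncation error is exponentially small in `N`, far below the claimed rate. -/
theorem one_div_pow_le_rate {N : ℕ} (hN : 1 ≤ N) (C : ℕ) :
    (1 / 32 : ℝ) ^ N ≤ Cbar C *
      Real.exp (-(2 * Real.exp 1)⁻¹ * (2 * (N : ℝ) + 1) ^ (1 / (2 * (1 + (C : ℝ))))) := by
  have hN' : (1 : ℝ) ≤ N := by exact_mod_cast hN
  have hC : (0 : ℝ) ≤ C := Nat.cast_nonneg C
  have he : 2 ≤ Real.exp 1 := by have := Real.add_one_le_exp (1 : ℝ); linarith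
  have h1 : (2 * (N : ℝ) + 1) ^ (1 / (2 * (1 + (C : ℝ)))) ≤ 2 * N + 1 := by
    refine (Real.rpow_le_rpow_of_exponent_le (by linarith) ?_).trans_eq (Real.rpow_one _)
    rw [div_le_one (by positivity)]; linarith
  have h0 : 0 ≤ (2 * (N : ℝ) + 1) ^ (1 / (2 * (1 + (C : ℝ)))) := by positivity
  have h2 : (2 * Real.exp 1)⁻¹ ≤ 1 / 4 := by
    rw [inv_le_comm₀ (by positivity) (by norm_num)]; linarith
  have h3 : -(N : ℝ) ≤
      -(2 * Real.exp 1)⁻¹ * (2 * (N : ℝ) + 1) ^ (1 / (2 * (1 + (C : ℝ)))) := by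
    have := mul_le_mul h2 h1 h0 (by norm_num)
    linarith
  have h4 : (1 / 32 : ℝ) ≤ Real.exp (-1) := by
    rw [Real.exp_neg, one_div]
    exact inv_anti₀ (Real.exp_pos _) (by linarith [Real.exp_one_lt_d9])
  calc (1 / 32 : ℝ) ^ N ≤ Real.exp (-1) ^ N := by gcongr
    _ = Real.exp (-(N : ℝ)) := by rw [← Real.exp_nat_mul]; ring_nf
    _ ≤ Real.exp (-(2 * Real.exp 1)⁻¹ * (2 * (N : ℝ) + 1) ^ (1 / (2 * (1 + (C : ℝ))))) :=
        Real.exp_le_exp.2 h3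
    _ ≤ _ := le_mul_of_one_le_left (Real.exp_pos _).le (by linarith [Cbar_ge C])

theorem rate_le_third {N C : ℕ} {ε : ℝ} (hε : 0 < ε) (hε1 : ε < 1)
    (h : (2 * Real.exp 1 * Real.log (3 * Cbar C / ε)) ^ (2 * (1 + C)) ≤ 2 * (N : ℝ) + 1) :
    Cbar C * Real.exp (-(2 * Real.exp 1)⁻¹ * (2 * (N : ℝ) + 1) ^ (1 / (2 * (1 + (C : ℝ))))) ≤
      ε / 3 := by
  have hCb := Cbar_ge C
  have hx : 0 < 3 * Cbar C / ε := by positivity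
  have hlog : 0 ≤ Real.log (3 * Cbar C / ε) := by
    refine Real.log_nonneg ?_
    rw [le_div_iff₀ hε]; linarith
  have h1 : 2 * Real.exp 1 * Real.log (3 * Cbar C / ε) ≤
      (2 * (N : ℝ) + 1) ^ (1 / (2 * (1 + (C : ℝ)))) := by
    have h2 := Real.rpow_le_rpow (by positivity) h
      (show (0 : ℝ) ≤ 1 / (2 * (1 + (C : ℝ))) by positivity)
    have h3 : (1 : ℝ) / (2 * (1 + (C : ℝ))) = ((2 * (1 + C) : ℕ) : ℝ)⁻¹ := by push_cast; simp
    rw [h3, Real.pow_rpow_inv_natCast (by positivity) (by omega)] at h2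
    rwa [h3]
  have h4 : Real.log (3 * Cbar C / ε) ≤
      (2 * Real.exp 1)⁻¹ * (2 * (N : ℝ) + 1) ^ (1 / (2 * (1 + (C : ℝ)))) := by
    rw [inv_mul_eq_div, le_div_iff₀ (by positivity)]
    linarith
  calc _ ≤ Cbar C * Real.exp (-Real.log (3 * Cbar C / ε)) := by
        gcongr
        linarith
    _ = ε / 3 := by
        rw [Real.exp_neg, Real.exp_log hx]
        field_simp

namespace RegularNegLogDensity

variable {ψ : ℝ → ℝ} {C : ℕ} {Ct : ℝ} {lam τ σ : ℝ} {N : ℕ}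

theorem contDiff_targetDensity (h : RegularNegLogDensity ψ C Ct) (τ θ : ℝ) :
    ContDiff ℝ (⊤ : ℕ∞) fun y => targetDensity ψ τ y θ := by
  unfold targetDensity
  exact contDiff_const.mul (h.contDiff_exp_neg.comp
    (g := fun t => Real.exp (-ψ t)) ((contDiff_id.sub contDiff_const).div_const τ))

theorem lintegral_targetDensity (h : RegularNegLogDensity ψ C Ct) (hτ : 0 < τ) (θ : ℝ) :
    ∫⁻ y, ENNReal.ofReal (targetDensity ψ τ y θ) = 1 := by
  have hm : Measurable fun t => Real.exp (-ψ t) := h.contDiff_exp_neg.continuous.measurable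
  exact (lintegral_scaled_density hτ θ hm).trans h.lintegral_exp_neg

theorem backwardHeat_targetDensity (h : RegularNegLogDensity ψ C Ct) (σ τ : ℝ) (N : ℕ) (z : ℝ) :
    backwardHeat σ N (fun y => targetDensity ψ τ y 0) z =
      1 / τ * backwardHeat (σ / τ) N (fun t => Real.exp (-ψ t)) (z / τ) := by
  rw [← sub_zero z, ← signedKernel_targetDensity h.smooth, signedKernel, backwardHeat]
  refine Finset.sum_congr rfl fun k _ => ?_
  have h1 : (fun θ => targetDensity ψ τ z θ) =
      fun θ => (fun y => targetDensity ψ τ y 0) (z - θ) := by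
    ext θ; simp [targetDensity]
  rw [h1, congrFun (iteratedDeriv_comp_const_sub (2 * k)
    (fun y => targetDensity ψ τ y 0) z) 0]
  simp

theorem lintegral_abs_iteratedDeriv_targetDensity_le (h : RegularNegLogDensity ψ C Ct)
    (hτ : 0 < τ) (hlam : 0 < lam) {n m : ℕ} (hn : 1 ≤ n) (hnm : n ≤ m) :
    ∫⁻ y, ENNReal.ofReal |iteratedDeriv n (fun y => targetDensity ψ τ y 0) y| ≤
      ENNReal.ofReal (n ! * (lam / τ) ^ n) * (1 + errTerm ψ m lam) := by
  have h1 : (fun y => targetDensity ψ τ y 0) =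
      fun y => 1 / τ * (fun t => Real.exp (-ψ t)) (τ⁻¹ * y) := by
    ext y; simp [targetDensity, div_eq_inv_mul]
  have h2 : ContDiff ℝ n (fun t => Real.exp (-ψ t)) := contDiff_infty.1 h.contDiff_exp_neg _
  have h3 : ∀ y, |iteratedDeriv n (fun y => targetDensity ψ τ y 0) y| =
      (1 / τ) ^ n * (1 / τ * |iteratedDeriv n (fun t => Real.exp (-ψ t)) ((y - 0) / τ)|) := by
    intro y
    rw [h1, iteratedDeriv_const_mul_field, iteratedDeriv_comp_const_mul h2, abs_mul, abs_mul,
      abs_of_pos (by positivity), abs_of_pos (by positivity), sub_zero, one_div, ← div_eq_inv_mul y]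
    ring
  simp_rw [h3]
  simp_rw [ENNReal.ofReal_mul (show (0 : ℝ) ≤ (1 / τ) ^ n by positivity)]
  rw [lintegral_const_mul' _ _ ENNReal.ofReal_ne_top, lintegral_scaled_density hτ 0
    (k := fun t => |iteratedDeriv n (fun t => Real.exp (-ψ t)) t|)
    (h.continuous_iteratedDeriv_exp_neg n).abs.measurable]
  refine (mul_le_mul_right (h.lintegral_abs_iteratedDeriv_le hlam hn hnm) _).trans (le_of_eq ?_)
  rw [← mul_assoc, ← ENNReal.ofReal_mul (by positivity)]
  congr 2
  rw [div_pow, div_pow]; ring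

theorem tvDist_mixture_le (h : RegularNegLogDensity ψ C Ct) (hτ : 0 < τ) (hσ : 0 < σ)
    (hlam : 0 < lam) (hN : 1 ≤ N) (hsl : σ / τ * lam * (2 * N) ≤ 1 / 8) (θ : ℝ) :
    tvDist (densMeasure fun y => ∫ x, normalizedPosPart
        (signedKernel (targetDensity ψ τ) σ N) y x * sourceDensity σ x θ)
      (densMeasure fun y => targetDensity ψ τ y θ) ≤
      ENNReal.ofReal ((1 / 32) ^ N) + 4 * errTerm ψ (2 * N) lam := by
  set v := (σ ^ 2).toNNReal with hv
  have hv0 : v ≠ 0 := toNNReal_sq_ne_zero hσ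
  have hvσ : σ ^ 2 = v := (Real.coe_toNNReal _ (by positivity)).symm
  set F : ℝ → ℝ := fun y => targetDensity ψ τ y 0 with hFdef
  set T := normalizedPosPart (signedKernel (targetDensity ψ τ) σ N) with hTdef
  set q : ℝ → ℝ := fun z => 1 / τ * unitKernel ψ (σ / τ) N (z / τ) with hqdef
  have hFs : ContDiff ℝ (⊤ : ℕ∞) F := h.contDiff_targetDensity τ 0
  have hTq : ∀ y x, T y x = q (y - x) := fun y x => h.normalizedPosPart_eq hτ σ N y x
  have hqm : Measurable q := by
    have := h.measurable_unitKernel (σ / τ) N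
    fun_prop
  have hgauss : gaussianReal θ v = (gaussianReal 0 v).map (θ + ·) := by
    rw [gaussianReal_map_const_add, zero_add]
  have hmix : ∀ y, ∫ x, T y x * sourceDensity σ x θ = ∫ k, q (y - θ - k) ∂gaussianReal 0 v := by
    intro y
    rw [integral_mul_sourceDensity hσ, ← hv, hgauss]
    simp_rw [hTq]
    have hm : Measurable fun x => q (y - x) := by fun_prop
    rw [integral_map (by fun_prop) hm.aestronglyMeasurable]
    simp_rw [sub_sub]
  have hFθ : ∀ y, targetDensity ψ τ y θ = F (y - θ) := fun y => by simp [hFdef, targetDensity]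
  simp_rw [hmix, hFθ]
  have hmixm : Measurable fun y => ∫ k, q (y - θ - k) ∂gaussianReal 0 v := by
    have : Measurable fun p : ℝ × ℝ => q (p.1 - θ - p.2) := by fun_prop
    exact this.stronglyMeasurable.integral_prod_right'.measurable
  have hFθm : Measurable fun y => F (y - θ) := hFs.continuous.measurable.comp (by fun_prop)
  refine (tvDist_densMeasure_le hmixm hFθm).trans ?_
  rw [lintegral_sub_right_eq_self
    (fun y => ENNReal.ofReal |∫ k, q (y - k) ∂gaussianReal 0 v - F y|) θ]
  set G := backwardHeat σ N F with hG
  have hGm : Measurable G := (continuous_backwardHeat_of_contDiff hFs σ N).measurable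
  have hPm : Measurable fun p : ℝ × ℝ => heatTaylor σ N F p.1 p.2 :=
    (continuous_heatTaylor hFs σ N).measurable
  have hint : ∀ᵐ y, Integrable (fun k => q (y - k)) (gaussianReal 0 v) := by
    filter_upwards [h.ae_integrable_normalizedPosPart hτ σ N (gaussianReal 0 v)] with y hy
    exact hy.congr (.of_forall fun x => hTq y x)
  have hpt : ∀ᵐ y, ENNReal.ofReal |∫ k, q (y - k) ∂gaussianReal 0 v - F y| ≤
      ∫⁻ k, (ENNReal.ofReal |q (y - k) - G (y - k)| +
        ENNReal.ofReal |G (y - k) - heatTaylor σ N F y k|) ∂gaussianReal 0 v := by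
    filter_upwards [hint] with y hy
    rw [← integral_heatTaylor hv0 hvσ hN F y,
      ← integral_sub hy (integrable_heatTaylor σ N F y v), ← Real.enorm_eq_ofReal_abs]
    refine (enorm_integral_le_lintegral_enorm _).trans (lintegral_mono fun k => ?_)
    rw [Real.enorm_eq_ofReal_abs, ← ENNReal.ofReal_add (abs_nonneg _) (abs_nonneg _)]
    exact ENNReal.ofReal_le_ofReal (abs_sub_le _ _ _)
  have hqG : ∀ k : ℝ, ∫⁻ y, ENNReal.ofReal |q (y - k) - G (y - k)| ≤ errTerm ψ (2 * N) lam := by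
    intro k
    have h1 : ∀ y, |q (y - k) - G (y - k)| = 1 / τ * |unitKernel ψ (σ / τ) N ((y - k) / τ) -
        backwardHeat (σ / τ) N (fun t => Real.exp (-ψ t)) ((y - k) / τ)| := by
      intro y
      rw [hG, hFdef, h.backwardHeat_targetDensity, hqdef, ← mul_sub, abs_mul,
        abs_of_pos (by positivity)]
    simp_rw [h1]
    rw [lintegral_scaled_density hτ k (k := fun t => |unitKernel ψ (σ / τ) N t -
      backwardHeat (σ / τ) N (fun t => Real.exp (-ψ t)) t|) ?_]
    · exact h.lintegral_abs_unitKernel_sub_le (by positivity) hlam hsl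
    · have h2 := h.measurable_unitKernel (σ / τ) N
      have h3 := (h.continuous_backwardHeat (σ / τ) N).measurable
      exact (h2.sub h3).abs
  have htrunc : ENNReal.ofReal ((N + 1) * σ ^ (2 * N)) *
      ∫⁻ y, ENNReal.ofReal |iteratedDeriv (2 * N) F y| ≤
        ENNReal.ofReal ((1 / 32) ^ N) + errTerm ψ (2 * N) lam := by
    refine (mul_le_mul_right (h.lintegral_abs_iteratedDeriv_targetDensity_le hτ hlam
      (show 1 ≤ 2 * N by omega) le_rfl) _).trans ?_
    rw [← mul_assoc, ← ENNReal.ofReal_mul (by positivity)]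
    have h1 : (N + 1) * σ ^ (2 * N) * (((2 * N)! : ℝ) * (lam / τ) ^ (2 * N)) ≤ (1 / 32) ^ N := by
      have h2 := pow_mul_factorial_mul_pow_le (show 0 ≤ σ / τ by positivity) hlam.le hsl le_rfl
      have h3 : (N : ℝ) + 1 ≤ 2 ^ N := by exact_mod_cast Nat.lt_two_pow_self
      calc _ = (N + 1) * ((σ / τ) ^ (2 * N) * (((2 * N)! : ℝ) * lam ^ (2 * N))) := by
            rw [div_pow, div_pow]; ring
        _ ≤ 2 ^ N * (1 / 64) ^ N := by gcongr
        _ = _ := by rw [← mul_pow]; norm_num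
    have h4 : ENNReal.ofReal ((1 / 32) ^ N) ≤ 1 := by
      rw [ENNReal.ofReal_le_one]; exact pow_le_one₀ (by norm_num) (by norm_num)
    calc _ ≤ ENNReal.ofReal ((1 / 32) ^ N) * (1 + errTerm ψ (2 * N) lam) := by gcongr
      _ ≤ _ := by
        rw [mul_add, mul_one]
        gcongr
        exact mul_le_of_le_one_left' h4
  calc ∫⁻ y, ENNReal.ofReal |∫ k, q (y - k) ∂gaussianReal 0 v - F y|
      ≤ ∫⁻ y, ∫⁻ k, (ENNReal.ofReal |q (y - k) - G (y - k)| +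
        ENNReal.ofReal |G (y - k) - heatTaylor σ N F y k|) ∂gaussianReal 0 v :=
        lintegral_mono_ae hpt
    _ = ∫⁻ k, ∫⁻ y, (ENNReal.ofReal |q (y - k) - G (y - k)| +
        ENNReal.ofReal |G (y - k) - heatTaylor σ N F y k|) ∂volume ∂gaussianReal 0 v :=
        lintegral_lintegral_swap (f := fun y k => ENNReal.ofReal |q (y - k) - G (y - k)| +
          ENNReal.ofReal |G (y - k) - heatTaylor σ N F y k|)
          (by unfold Function.uncurry; fun_prop)
    _ = ∫⁻ k, ((∫⁻ y, ENNReal.ofReal |q (y - k) - G (y - k)|) +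
        ∫⁻ y, ENNReal.ofReal |G (y - k) - heatTaylor σ N F y k|) ∂gaussianReal 0 v := by
        refine lintegral_congr fun k => lintegral_add_left ?_ _
        fun_prop
    _ ≤ ∫⁻ k, (errTerm ψ (2 * N) lam +
        ∫⁻ y, ENNReal.ofReal |G (y - k) - heatTaylor σ N F y k|) ∂gaussianReal 0 v :=
        lintegral_mono fun k => by gcongr; exact hqG k
    _ = errTerm ψ (2 * N) lam + ∫⁻ k, ∫⁻ y,
        ENNReal.ofReal |G (y - k) - heatTaylor σ N F y k| ∂volume ∂gaussianReal 0 v := by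
        rw [lintegral_add_left measurable_const]; simp
    _ ≤ errTerm ψ (2 * N) lam + (ENNReal.ofReal ((1 / 32) ^ N) + errTerm ψ (2 * N) lam) := by
        gcongr
        exact (lintegral_backwardHeat_sub_heatTaylor_le hv0 hσ.le hvσ N hFs).trans htrunc
    _ = ENNReal.ofReal ((1 / 32) ^ N) + 2 * errTerm ψ (2 * N) lam := by ring
    _ ≤ _ := by gcongr; norm_num

end RegularNegLogDensity

/-! ### The acceptance step of the rejection sampler -/

/-- A uniform variable falls below `S / b` with probability `max S 0 / b`. -/
theorem lintegral_unif_ite {S b : ℝ} (hb : 0 < b) (hSb : S ≤ b) (c d : ℝ≥0∞) :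
    ∫⁻ u, (if 0 < S - b * u then c else d) ∂unifMeasure =
      ENNReal.ofReal (max S 0 / b) * c + ENNReal.ofReal (1 - max S 0 / b) * d := by
  have hset : MeasurableSet (Set.Iio (S / b)) := measurableSet_Iio
  have hr : max S 0 / b = max (S / b) 0 := by
    rcases le_total 0 S with h | h
    · rw [max_eq_left h, max_eq_left (by positivity)]
    · rw [max_eq_right h, max_eq_right (div_nonpos_of_nonpos_of_nonneg h hb.le), zero_div]
  have hle : S / b ≤ 1 := (div_le_one hb).2 hSb
  have hiff : ∀ u, 0 < S - b * u ↔ u < S / b := fun u => by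
    rw [lt_div_iff₀ hb, sub_pos, mul_comm]
  rw [← lintegral_add_compl _ hset, setLIntegral_congr_fun hset (g := fun _ => c)
    (fun u hu => if_pos ((hiff u).2 hu)), setLIntegral_congr_fun hset.compl (g := fun _ => d)
    (fun u hu => if_neg fun h => hu ((hiff u).1 h)), setLIntegral_const, setLIntegral_const,
    unifMeasure, Measure.restrict_apply hset, Measure.restrict_apply hset.compl, hr]
  have h1 : Set.Iio (S / b) ∩ Set.Icc 0 1 = Set.Ico 0 (S / b) := by
    ext u; simp only [Set.mem_inter_iff, Set.mem_Iio, Set.mem_Icc, Set.mem_Ico]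
    constructor
    · rintro ⟨h1, h2, h3⟩; exact ⟨h2, h1⟩
    · rintro ⟨h1, h2⟩; exact ⟨h2, h1, by linarith⟩
  have h2 : (Set.Iio (S / b))ᶜ ∩ Set.Icc 0 1 = Set.Icc (max (S / b) 0) 1 := by
    ext u
    simp only [Set.mem_inter_iff, Set.mem_compl_iff, Set.mem_Iio, Set.mem_Icc, not_lt, max_le_iff]
    tauto
  rw [h1, h2, Real.volume_Ico, Real.volume_Icc, sub_zero, mul_comm c, mul_comm d]
  congr 2
  rcases le_total 0 (S / b) with h | h
  · rw [max_eq_left h]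
  · rw [max_eq_right h, ENNReal.ofReal_of_nonpos h, ENNReal.ofReal_zero]

theorem ratioBound_ne_zero (ψ : ℝ → ℝ) {n : ℕ} (hn : 1 ≤ n) {lam : ℝ} (hlam : 0 < lam) :
    ratioBound ψ n lam ≠ 0 := by
  have h1 : ENNReal.ofReal (Real.exp (-ψ 0 + ψ (0 / 2)) * (1 + derivSum ψ n lam 0 ^ 1)) ≤
      ratioBound ψ n lam :=
    (le_iSup (fun t : ℝ => ENNReal.ofReal (Real.exp (-ψ t + ψ (t / 2)) *
      (1 + derivSum ψ n lam t ^ 1))) 0).trans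
      (le_iSup₂ (f := fun k (_ : k ∈ Finset.Icc 1 n) => ⨆ t : ℝ, ENNReal.ofReal
        (Real.exp (-ψ t + ψ (t / 2)) * (1 + derivSum ψ n lam t ^ k))) 1
        (Finset.mem_Icc.2 ⟨le_rfl, hn⟩))
  refine (lt_of_lt_of_le (ENNReal.ofReal_pos.2 ?_) h1).ne'
  have := derivSum_nonneg ψ n hlam 0
  positivity

theorem measurable_signedKernel_targetDensity {ψ : ℝ → ℝ} {C : ℕ} {Ct : ℝ}
    (h : RegularNegLogDensity ψ C Ct) (τ σ : ℝ) (N : ℕ) (x : ℝ) :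
    Measurable fun y => signedKernel (targetDensity ψ τ) σ N y x := by
  simp_rw [signedKernel_targetDensity h.smooth]
  have := (h.continuous_backwardHeat (σ / τ) N).measurable
  fun_prop

theorem isProbabilityMeasure_densMeasure {T : ℝ → ℝ → ℝ} (hT : IsMarkovDensity T) (x : ℝ) :
    IsProbabilityMeasure (densMeasure fun y => T y x) :=
  ⟨by rw [densMeasure, withDensity_apply _ .univ, Measure.restrict_univ, (hT x).2.2]⟩

namespace RegularNegLogDensity

variable {ψ : ℝ → ℝ} {C : ℕ} {Ct : ℝ} {lam τ σ : ℝ} {N : ℕ}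

/-- A round with the proposal `x + 2 τ t`, `t ∼ exp (-ψ)`, accepts with some probability
`a ≥ 1 / (4 M)`, and an accepted proposal follows the normalized kernel. Here `2 M / τ` bounds the
ratio of the signed kernel to `exp (-ψ t)`, and `a` is the mass of the positive part over `4 M`. -/
theorem exists_acceptance (h : RegularNegLogDensity ψ C Ct) (hτ : 0 < τ) (hσ : 0 < σ)
    (hlam : 0 < lam) (hN : 1 ≤ N) (hsl : σ / τ * lam * (2 * N) ≤ 1 / 8)
    (hM : ratioBound ψ (2 * N) lam ≠ ⊤) :
    ∃ a : ℝ, 1 / (4 * (ratioBound ψ (2 * N) lam).toReal) ≤ a ∧ a ≤ 1 ∧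
      ∀ (x : ℝ) (H : ℝ → ℝ≥0∞) (r : ℝ), Measurable H →
        ∫⁻ t, ∫⁻ u, H (Cmd.rejectionUpdate (signedKernel (targetDensity ψ τ) σ N)
            (fun t => Real.exp (-ψ t)) (2 * τ) (2 * (ratioBound ψ (2 * N) lam).toReal / τ)
            x r t u) ∂unifMeasure ∂densMeasure (fun t => Real.exp (-ψ t)) =
          ENNReal.ofReal (1 - a) * H r + ENNReal.ofReal a * ∫⁻ y, H y ∂densMeasure
            (fun y => normalizedPosPart (signedKernel (targetDensity ψ τ) σ N) y x) := by
  set M := (ratioBound ψ (2 * N) lam).toReal with hMdef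
  have hM0 : 0 < M := ENNReal.toReal_pos (ratioBound_ne_zero ψ (by omega) hlam) hM
  set f : ℝ → ℝ := fun t => Real.exp (-ψ t) with hf
  have hfm : Measurable f := h.contDiff_exp_neg.continuous.measurable
  set g := backwardHeat (σ / τ) N f with hg
  have hgm : Measurable g := (h.continuous_backwardHeat (σ / τ) N).measurable
  set p := ∫ t, max (g t) 0 with hp
  have hp1 : 1 ≤ p := h.one_le_integral_posPart_backwardHeat (σ / τ) N
  set a := p / (4 * M) with ha
  have ha0 : 0 ≤ a := by positivity
  set w : ℝ → ℝ := fun t => max (g (2 * t)) 0 / (2 * M) with hw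
  have hwm : Measurable w := by fun_prop
  have hdom : ∀ t, g (2 * t) ≤ 2 * M * f t := by
    intro t
    have h1 := h.exp_mul_backwardHeat_le (show 0 ≤ σ / τ by positivity) hlam hsl hN hM (2 * t)
    rw [show 2 * t / 2 = t by ring] at h1
    have h2 : f t * Real.exp (ψ t) = 1 := by rw [hf, ← Real.exp_add]; simp
    calc g (2 * t) = f t * (Real.exp (ψ t) * g (2 * t)) := by rw [← mul_assoc, h2, one_mul]
      _ ≤ f t * (2 * M) := mul_le_mul_of_nonneg_left h1 (Real.exp_pos _).le
      _ = _ := by ring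
  have hw0 : ∀ t, 0 ≤ w t := fun t => div_nonneg (le_max_right _ _) (by positivity)
  have hwf : ∀ t, w t ≤ f t := by
    intro t
    rw [hw]
    refine (div_le_iff₀ (by positivity)).2 (max_le ?_ ?_)
    · linarith [hdom t]
    · have := (Real.exp_pos (-ψ t)).le
      positivity
  -- one round, with the uniform number integrated out
  have hround : ∀ (x : ℝ) (H : ℝ → ℝ≥0∞) (r : ℝ), Measurable H →
      ∫⁻ t, ∫⁻ u, H (Cmd.rejectionUpdate (signedKernel (targetDensity ψ τ) σ N)
        f (2 * τ) (2 * M / τ) x r t u) ∂unifMeasure ∂densMeasure f =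
      (∫⁻ t, ENNReal.ofReal (w t) * H (2 * τ * t + x)) +
        (∫⁻ t, ENNReal.ofReal (f t - w t)) * H r := by
    intro x H r hH
    have hinner : ∀ t, ∫⁻ u, H (Cmd.rejectionUpdate (signedKernel (targetDensity ψ τ) σ N)
        f (2 * τ) (2 * M / τ) x r t u) ∂unifMeasure =
        ENNReal.ofReal (w t / f t) * H (2 * τ * t + x) +
          ENNReal.ofReal (1 - w t / f t) * H r := by
      intro t
      have hft : 0 < f t := Real.exp_pos _
      have hS : signedKernel (targetDensity ψ τ) σ N (2 * τ * t + x) x = 1 / τ * g (2 * t) := by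
        rw [signedKernel_targetDensity h.smooth]
        congr 2
        field_simp; ring
      have hr : max (1 / τ * g (2 * t)) 0 / (f t * (2 * M / τ)) = w t / f t := by
        rw [show (0 : ℝ) = 1 / τ * 0 by ring, ← mul_max_of_nonneg _ _ (by positivity), hw]
        field_simp
      rw [← hr, ← lintegral_unif_ite (by positivity)]
      · refine lintegral_congr fun u => ?_
        rw [Cmd.rejectionUpdate, hS]
        split_ifs <;> rfl
      · rw [one_div, inv_mul_le_iff₀ hτ]
        refine (hdom t).trans_eq ?_
        field_simp
    simp_rw [hinner]
    rw [densMeasure, lintegral_withDensity_eq_lintegral_mul _ (by fun_prop) (by fun_prop)]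
    rw [← lintegral_mul_const _ (by fun_prop), ← lintegral_add_left (by fun_prop)]
    refine lintegral_congr fun t => ?_
    have hft : 0 < f t := Real.exp_pos _
    rw [Pi.mul_apply, mul_add, ← mul_assoc, ← mul_assoc, ← ENNReal.ofReal_mul hft.le,
      ← ENNReal.ofReal_mul hft.le]
    congr 3
    · field_simp
    · field_simp
  have hfirst : ∀ (x : ℝ) (H : ℝ → ℝ≥0∞), Measurable H →
      ∫⁻ t, ENNReal.ofReal (w t) * H (2 * τ * t + x) = ENNReal.ofReal a *
        ∫⁻ y, H y ∂densMeasure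
          (fun y => normalizedPosPart (signedKernel (targetDensity ψ τ) σ N) y x) := by
    intro x H hH
    have hTm : Measurable fun y => normalizedPosPart (signedKernel (targetDensity ψ τ) σ N) y x :=
      (h.isMarkovDensity_normalizedPosPart hτ σ N x).1
    rw [densMeasure, lintegral_withDensity_eq_lintegral_mul _ hTm.ennreal_ofReal hH,
      lintegral_affine (show 0 < 2 * τ by positivity) x (hTm.ennreal_ofReal.mul hH), ← mul_assoc,
      ← ENNReal.ofReal_mul ha0, ← lintegral_const_mul' _ _ ENNReal.ofReal_ne_top]
    refine lintegral_congr fun t => ?_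
    rw [Pi.mul_apply, ← mul_assoc, ← ENNReal.ofReal_mul (by positivity),
      h.normalizedPosPart_eq hτ, show (2 * τ * t + x - x) / τ = 2 * t by field_simp; ring]
    congr 2
    have : p ≠ 0 := by linarith
    rw [unitKernel, ← hf, ← hg, ← hp, ha, hw]
    field_simp
    ring
  have hmass : ENNReal.ofReal a + ∫⁻ t, ENNReal.ofReal (f t - w t) = 1 := by
    have h1 := hfirst 0 (fun _ => 1) measurable_const
    have := isProbabilityMeasure_densMeasure (h.isMarkovDensity_normalizedPosPart hτ σ N) 0
    simp only [mul_one, lintegral_const, measure_univ] at h1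
    rw [← h1, ← lintegral_add_left (by fun_prop), ← h.lintegral_exp_neg]
    refine lintegral_congr fun t => ?_
    rw [← ENNReal.ofReal_add (hw0 t) (by linarith [hwf t])]
    simp [hf]
  have ha1 : a ≤ 1 := by
    rw [← ENNReal.ofReal_le_one, ← hmass]; exact le_self_add
  have hsecond : ∫⁻ t, ENNReal.ofReal (f t - w t) = ENNReal.ofReal (1 - a) := by
    rw [ENNReal.ofReal_sub _ ha0, ENNReal.ofReal_one, ← hmass]
    exact (ENNReal.add_sub_cancel_left ENNReal.ofReal_ne_top).symm
  refine ⟨a, ?_, ha1, fun x H r hH => ?_⟩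
  · rw [ha]; gcongr
  · rw [hround x H r hH, hfirst x H hH, hsecond, add_comm]

end RegularNegLogDensity

/-! ### The reduction algorithm -/

theorem tvDist_le_one {μ ν : Measure ℝ} (hμ : μ Set.univ ≤ 1) (hν : ν Set.univ ≤ 1) :
    tvDist μ ν ≤ 1 :=
  iSup₂_le fun _ _ => max_le (tsub_le_self.trans ((measure_mono (Set.subset_univ _)).trans hμ))
    (tsub_le_self.trans ((measure_mono (Set.subset_univ _)).trans hν))

theorem Cmd.HaltsWithin.mono {P : Primitives} {p : Cmd P} {z : ℝ × ℝ} {S T : ℕ}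
    (h : p.HaltsWithin z S) (hST : S ≤ T) : p.HaltsWithin z T :=
  ⟨h.1, h.2.mono fun _ hr => hr.trans hST⟩

theorem Cmd.haltsWithin_const {P : Primitives} (d : ℕ) (c : ℝ) (z : ℝ × ℝ) :
    (Cmd.const d c : Cmd P).HaltsWithin z 1 := by
  have hm : Measurable fun s : MState => (s.1 0, s.2) := (measurable_reg 0).prodMk measurable_snd
  rw [Cmd.HaltsWithin, Cmd.run_apply, Cmd.sem_const_apply, Measure.map_dirac' hm]
  simp [ae_dirac_eq, write, initState]

theorem Cmd.HaltsWithin.out_univ {P : Primitives} {p : Cmd P} {z : ℝ × ℝ} {T : ℕ}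
    (h : p.HaltsWithin z T) : p.out z Set.univ = 1 := by
  rw [Cmd.out, Kernel.map_apply' _ measurable_fst _ .univ, Set.preimage_univ, h.1]

theorem bind_out_apply {P : Primitives} (K : Cmd P) (n : ℝ) (γ : Measure ℝ) {A : Set ℝ}
    (hA : MeasurableSet A) :
    γ.bind (fun x => K.out (x, n)) A = ∫⁻ x, K.out (x, n) A ∂γ :=
  Measure.bind_apply hA (K.out.measurable.comp (by fun_prop)).aemeasurable

/-- Mixing a law with weight `q` into something else, of which only the values on sets enter, moves
it by at most `q` in total variation. -/
theorem tvDist_mixture_le_add {κ μ ν : Measure ℝ} {q : ℝ} (hq0 : 0 ≤ q) (hq1 : q ≤ 1)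
    (hμ : μ Set.univ ≤ 1) (δ : Set ℝ → ℝ≥0∞) (hδ : ∀ A, δ A ≤ 1)
    (hκ : ∀ A, MeasurableSet A →
      κ A = ENNReal.ofReal q * δ A + ENNReal.ofReal (1 - q) * μ A) :
    tvDist κ ν ≤ ENNReal.ofReal q + tvDist μ ν := by
  have h1q : ENNReal.ofReal (1 - q) ≤ 1 := by rw [ENNReal.ofReal_le_one]; linarith
  have hsum : ENNReal.ofReal q + ENNReal.ofReal (1 - q) = 1 := by
    rw [← ENNReal.ofReal_add hq0 (by linarith)]; simp
  refine iSup₂_le fun A hA => ?_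
  have hD : max (μ A - ν A) (ν A - μ A) ≤ tvDist μ ν :=
    le_iSup₂ (f := fun A (_ : MeasurableSet A) => max (μ A - ν A) (ν A - μ A)) A hA
  have hμA : μ A ≤ 1 := (measure_mono (Set.subset_univ _)).trans hμ
  have hκμ : κ A ≤ ENNReal.ofReal q + μ A := by
    rw [hκ A hA]
    exact add_le_add (mul_le_of_le_one_right' (hδ A)) (mul_le_of_le_one_left' h1q)
  have hμκ : μ A ≤ ENNReal.ofReal q + κ A := by
    calc μ A = ENNReal.ofReal q * μ A + ENNReal.ofReal (1 - q) * μ A := by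
          rw [← add_mul, hsum, one_mul]
      _ ≤ ENNReal.ofReal q + κ A := by
          rw [hκ A hA]
          exact add_le_add (mul_le_of_le_one_right' hμA) le_add_self
  refine max_le (tsub_le_iff_right.2 ?_) (tsub_le_iff_right.2 ?_)
  · calc κ A ≤ ENNReal.ofReal q + μ A := hκμ
      _ ≤ ENNReal.ofReal q + (tvDist μ ν + ν A) := by
        gcongr
        exact tsub_le_iff_right.1 ((le_max_left _ _).trans hD)
      _ = _ := (add_assoc _ _ _).symm
  · calc ν A ≤ tvDist μ ν + μ A := tsub_le_iff_right.1 ((le_max_right _ _).trans hD)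
      _ ≤ tvDist μ ν + (ENNReal.ofReal q + κ A) := by gcongr
      _ = _ := by ring

namespace RegularNegLogDensity

variable {ψ : ℝ → ℝ} {C : ℕ} {Ct : ℝ} {lam τ σ : ℝ} {N : ℕ}

/-- The rejection sampler halts in time, and in total variation it adds only the probability of
never accepting to the deficiency of the normalized kernel. -/
theorem exists_program (h : RegularNegLogDensity ψ C Ct) (hτ : 0 < τ) (hσ : 0 < σ)
    (hlam : 0 < lam) (hN : 1 ≤ N) (hsl : σ / τ * lam * (2 * N) ≤ 1 / 8)
    {P : Primitives} {samp ev dens : Cmd P} {Ts Te : ℕ}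
    (hsamp : samp.Samples (densMeasure (fun t => Real.exp (-ψ t))) Ts)
    (hev : ev.Computes (fun z => signedKernel (targetDensity ψ τ) σ N z.2 z.1) Te)
    (hdens : dens.Computes (fun z => Real.exp (-ψ z.1)) Te) :
    ∃ K : Cmd P, ∀ n : ℕ,
      (∀ x : ℝ, K.HaltsWithin (x, (n : ℝ)) (n * (16 + Ts + 2 * Te) + 2)) ∧
      ∀ θ : ℝ, tvDist ((gaussianReal θ (σ ^ 2).toNNReal).bind fun x => K.out (x, (n : ℝ)))
          (densMeasure fun y => targetDensity ψ τ y θ) ≤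
        ENNReal.ofReal (Real.exp (-((n : ℝ≥0∞) / (4 * ratioBound ψ (2 * N) lam)).toReal)) +
          tvDist (densMeasure fun y => ∫ x, normalizedPosPart
              (signedKernel (targetDensity ψ τ) σ N) y x * sourceDensity σ x θ)
            (densMeasure fun y => targetDensity ψ τ y θ) := by
  by_cases hM : ratioBound ψ (2 * N) lam = ⊤
  · -- no bound on the density ratio: the claimed error is at least `1`, and any program will do
    refine ⟨.const 0 0, fun n => ⟨fun x => (Cmd.haltsWithin_const 0 0 _).mono (by omega),
      fun θ => ?_⟩⟩
    have h1 : ENNReal.ofReal (Real.exp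
        (-((n : ℝ≥0∞) / (4 * ratioBound ψ (2 * N) lam)).toReal)) = 1 := by
      rw [hM, ENNReal.mul_top (by norm_num), ENNReal.div_top]; simp
    rw [h1]
    refine le_trans (tvDist_le_one ?_ ?_) le_self_add
    · rw [bind_out_apply _ _ _ .univ]
      simp [(Cmd.haltsWithin_const 0 0 _).out_univ]
    · rw [densMeasure, withDensity_apply _ .univ, Measure.restrict_univ,
        h.lintegral_targetDensity hτ]
  obtain ⟨a, haM, ha1, hstep⟩ := h.exists_acceptance hτ hσ hlam hN hsl hM
  set M := (ratioBound ψ (2 * N) lam).toReal with hMdef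
  have hM0 : 0 < M := ENNReal.toReal_pos (ratioBound_ne_zero ψ (by omega) hlam) hM
  have ha0 : 0 ≤ a := le_trans (by positivity) haM
  have hmark := h.isMarkovDensity_normalizedPosPart hτ σ N
  have hS := measurable_signedKernel_targetDensity h τ σ N
  have hfm : Measurable fun t => Real.exp (-ψ t) := h.contDiff_exp_neg.continuous.measurable
  have hprob := fun x => isProbabilityMeasure_densMeasure hmark x
  refine ⟨Cmd.rejectionSampler samp ev dens (2 * τ) (2 * M / τ), fun n => ⟨fun x => ?_,
    fun θ => ?_⟩⟩
  · have := hprob x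
    exact Cmd.haltsWithin_rejectionSampler (S := signedKernel (targetDensity ψ τ) σ N)
      (f := fun t => Real.exp (-ψ t)) _ _ hsamp hev hdens hS hfm ha0 ha1 (hstep x) n
  set v := (σ ^ 2).toNNReal with hv
  set q := (1 - a) ^ n with hq
  have hq0 : 0 ≤ q := pow_nonneg (by linarith) n
  have hq1 : q ≤ 1 := pow_le_one₀ (by linarith) (by linarith)
  have hqexp : ENNReal.ofReal q ≤
      ENNReal.ofReal (Real.exp (-((n : ℝ≥0∞) / (4 * ratioBound ψ (2 * N) lam)).toReal)) := by
    refine ENNReal.ofReal_le_ofReal ?_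
    rw [ENNReal.toReal_div, ENNReal.toReal_mul, ← hMdef, ENNReal.toReal_natCast,
      ENNReal.toReal_ofNat]
    calc q ≤ Real.exp (-a) ^ n :=
          pow_le_pow_left₀ (by linarith) (Real.one_sub_le_exp_neg a) n
      _ = Real.exp (-(n * a)) := by rw [← Real.exp_nat_mul]; ring_nf
      _ ≤ _ := by
          refine Real.exp_le_exp.2 (neg_le_neg ?_)
          rw [div_eq_mul_one_div]
          gcongr
  refine (tvDist_mixture_le_add hq0 hq1 (μ := densMeasure fun y => ∫ x, normalizedPosPart
    (signedKernel (targetDensity ψ τ) σ N) y x * sourceDensity σ x θ) ?_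
    (fun A => ∫⁻ x, A.indicator 1 x ∂gaussianReal θ v) (fun A => ?_) fun A hA => ?_).trans
    (by gcongr)
  · rw [← h.lintegral_densMeasure_normalizedPosPart hτ hσ N θ .univ]
    simp [measure_univ]
  · calc ∫⁻ x, A.indicator 1 x ∂gaussianReal θ v ≤ ∫⁻ _, 1 ∂gaussianReal θ v :=
          lintegral_mono fun x => Set.indicator_le_self' (fun _ _ => zero_le_one) x
      _ = 1 := by simp
  · have hind : Measurable (A.indicator (1 : ℝ → ℝ≥0∞)) := measurable_one.indicator hA
    have hout : ∀ x : ℝ,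
        (Cmd.rejectionSampler samp ev dens (2 * τ) (2 * M / τ)).out (x, (n : ℝ)) A =
          ENNReal.ofReal q * A.indicator 1 x + ENNReal.ofReal (1 - q) * densMeasure
            (fun y => normalizedPosPart (signedKernel (targetDensity ψ τ) σ N) y x) A := by
      intro x
      have := hprob x
      rw [← lintegral_indicator_one hA, Cmd.lintegral_out _ _ hind,
        Cmd.lintegral_rejectionSampler (Φ := fun s => A.indicator 1 (s.1 0))
          (S := signedKernel (targetDensity ψ τ) σ N)
          (f := fun t => Real.exp (-ψ t)) _ _ hsamp hev hdens hS hfm ha0 ha1 (hstep x)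
          (hind.comp (measurable_reg 0)) hind n fun _ _ => rfl, lintegral_indicator_one hA]
    rw [bind_out_apply _ _ _ hA]
    simp_rw [hout]
    rw [lintegral_add_left (hind.const_mul _), lintegral_const_mul _ hind,
      lintegral_const_mul' _ _ ENNReal.ofReal_ne_top,
      h.lintegral_densMeasure_normalizedPosPart hτ hσ N θ hA]

end RegularNegLogDensity

theorem theorem1 :
    ∃ c : ℕ, ∀ (ψ : ℝ → ℝ) (C : ℕ) (Ct : ℝ) (N : ℕ) (τ lam σ : ℝ),
      RegularNegLogDensity ψ C Ct →
      Cbar C ≤ 2 * (N : ℝ) + 1 →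
      8 * Real.exp 1 * σ * max Ct (lam * N) ≤ τ →
      0 < σ → 0 < lam →
      -- the normalized positive part is a Markov kernel, with the claimed deficiency
      (IsMarkovDensity (normalizedPosPart (signedKernel (targetDensity ψ τ) σ N)) ∧
        deficiency (sourceDensity σ) (targetDensity ψ τ)
            (normalizedPosPart (signedKernel (targetDensity ψ τ) σ N)) ≤
          ENNReal.ofReal (Cbar C *
            Real.exp (-(2 * Real.exp 1)⁻¹ * (2 * (N : ℝ) + 1) ^ (1 / (2 * (1 + (C : ℝ)))))) +
          4 * errTerm ψ (2 * N) lam) ∧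
      -- the reduction algorithm: the program `K` gets the source sample and the iteration number
      (∀ ε : ℝ, 0 < ε → ε < 1 →
        (2 * Real.exp 1 * Real.log (3 * Cbar C / ε)) ^ (2 * (1 + C)) ≤ 2 * (N : ℝ) + 1 →
        ∀ (P : Primitives) (samp ev dens : Cmd P) (Tsamp Teval : ℕ),
          0 < Tsamp → 0 < Teval →
          samp.Samples (densMeasure (fun t => Real.exp (-ψ t))) Tsamp →
          ev.Computes (fun z => signedKernel (targetDensity ψ τ) σ N z.2 z.1) Teval →
          dens.Computes (fun z => Real.exp (-ψ z.1)) Teval →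
          ∃ K : Cmd P, ∀ Titer : ℕ, 0 < Titer →
            (∀ x : ℝ, K.HaltsWithin (x, (Titer : ℝ)) (c * (Titer * Tsamp * Teval))) ∧
            (⨆ θ : ℝ, tvDist
                ((gaussianReal θ (σ ^ 2).toNNReal).bind (fun x => K.out (x, (Titer : ℝ))))
                (densMeasure (fun y => targetDensity ψ τ y θ))) ≤
              ENNReal.ofReal
                  (Real.exp (-((Titer : ℝ≥0∞) / (4 * ratioBound ψ (2 * N) lam)).toReal)) +
                ENNReal.ofReal (ε / 3) + 4 * errTerm ψ (2 * N) lam) := by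
  -- `21 = 16 + 1 + 2 + 2`: the running time is at most `Titer * (16 + Tsamp + 2 * Teval + 2)`
  refine ⟨21, fun ψ C Ct N τ lam σ h hCN hτσ hσ hlam => ?_⟩
  have hN : 1 ≤ N := by
    have h1 := (Cbar_ge C).trans hCN
    by_contra h0
    have : N = 0 := by omega
    subst this
    norm_num at h1
  have he : 2 ≤ Real.exp 1 := by have := Real.add_one_le_exp (1 : ℝ); linarith
  have hmax : 0 < max Ct (lam * N) := lt_max_of_lt_left h.const_pos
  have hτ : 0 < τ := lt_of_lt_of_le (by positivity) hτσ
  have hsl : σ / τ * lam * (2 * N) ≤ 1 / 8 := by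
    have h1 : 8 * Real.exp 1 * σ * (lam * N) ≤ τ :=
      le_trans (by gcongr; exact le_max_right _ _) hτσ
    have h2 : 8 * 2 * σ * (lam * N) ≤ 8 * Real.exp 1 * σ * (lam * N) := by gcongr
    rw [show σ / τ * lam * (2 * N) = (σ * lam * (2 * N)) / τ by ring, div_le_iff₀ hτ]
    linarith
  have htv := h.tvDist_mixture_le hτ hσ hlam hN hsl
  refine ⟨⟨h.isMarkovDensity_normalizedPosPart hτ σ N, iSup_le fun θ => (htv θ).trans ?_⟩, ?_⟩
  · gcongr
    exact one_div_pow_le_rate hN C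
  intro ε hε hε1 hεN P samp ev dens Tsamp Teval hTs hTe hsamp hev hdens
  obtain ⟨K, hK⟩ := h.exists_program hτ hσ hlam hN hsl hsamp hev hdens
  refine ⟨K, fun n hn => ⟨fun x => ((hK n).1 x).mono ?_, iSup_le fun θ => ?_⟩⟩
  · have h1 : Tsamp ≤ Tsamp * Teval := Nat.le_mul_of_pos_right _ hTe
    have h2 : Teval ≤ Tsamp * Teval := Nat.le_mul_of_pos_left _ hTs
    have h3 : 1 ≤ Tsamp * Teval := Nat.mul_pos hTs hTe
    calc n * (16 + Tsamp + 2 * Teval) + 2 ≤ n * (16 + Tsamp + 2 * Teval) + n * 2 := by omega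
      _ = n * (16 + Tsamp + 2 * Teval + 2) := by ring
      _ ≤ n * (21 * (Tsamp * Teval)) := Nat.mul_le_mul_left _ (by omega)
      _ = _ := by ring
  · refine ((hK n).2 θ).trans ?_
    rw [add_assoc]
    gcongr
    refine (htv θ).trans ?_
    gcongr
    exact (one_div_pow_le_rate hN C).trans (rate_le_third hε hε1 hεN)
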